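/- Write $[n]=\{1,\dots,n\}$. A composition of $n$ of length $\ell$ is a tuple of $\ell$ positive integers summing to $n$. A cycle coloring of a permutation $\pi$ of $[n]$ in $[q]$ is a map $c:[n]\to[q]$ that is constant on the cycles of $\pi$. Let $n\ge 1$, let $\gamma=(\gamma_1,\dots,\gamma_\ell)$ be a composition of $n$, and let $k,r\ge 0$. For a composition $\delta=(\delta_1,\dots,\delta_{\ell'})$ of $n$ of length $\ell'=k+r$, let $B_{\gamma,\delta}$ be the set of triples $(\pi,c_1,c_2)$, where $\pi$ is a permutation of $[n]$, $c_1$ is a cycle coloring of $\pi$ with $\gamma_i$ elements colored $i$ for all $i\in[\ell]$, and $c_2$ is a cycle coloring of $\sigma=\pi\circ(1,2,\dots,n)$ with $\delta_i$ elements colored $i$ for all $i\in[\ell']$. For a composition $\alpha=(\alpha_1,\dots,\alpha_k)$ of some $m\le n$, let $T_\gamma^\alpha(r)$ be the set of quadruples $(\pi,A,c_1,c_2)$, where $\pi$ is a permutation of $[n]$, $A=(A_1,\dots,A_k)$ is a tuple of pairwise disjoint subsets of $[n]$ with $\#A_i=\alpha_i$, $c_1$ is a cycle coloring of $\pi$ with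 $\gamma_i$ elements colored $i$ for all $i\in[\ell]$, and $c_2$ is a cycle coloring of $\pi\circ(1,2,\dots,n)$ in $[k+r]$ that uses every color of $[k+r]$ and such that the elements of $A_i$ are colored $i$ for all $i\in[k]$. Let $T_{\gamma,\delta}^\alpha$ be the set of those elements of $T_\gamma^\alpha(r)$ for which $c_2$ has $\delta_i$ elements colored $i$ for all $i\in[k+r]$. A map is a cellular embedding of a connected graph (multiple edges allowed) in an oriented surface up to orientation-preserving homeomorphism; equivalently, a connected graph with a cyclic ordering of the half-edges around each vertex (a rotation system), up to isomorphism. A bipartite tree-rooted map is a bipartite map with a distinguished root half-edge and a marked spanning tree; its vertices are properly colored black and white with the root half-edge at a black vertex. It is $(\ell,\ell')$-labelled if it has $\ell$ black vertices labelled with distinct labels in $[\ell]$ and $\ell'$ white vertices labelled with distinct labels in $[\ell']$. It is $\alpha$-marked if some edges are marked so that exactly $\alpha_i$ marked edges are incident to the white vertex labelled $i$ for each $i\in[k]$, and no other edge is marked. To $(\pi,c_1,c_2)\in B_{\gamma,\delta}$ associate the graph with black vertices $[\ell]$, white vertices $[\ell']$ and edge set $[n]$, where the edge $t$ joins the black vertex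 $c_1(t)$ to the white vertex $c_2(t)$, together with the closed tour which, for $t=1,\dots,n$ successively, follows the edge $t$ from black to white and then the edge $\sigma(t)$ from white to black. Let $\Phi(\pi,c_1,c_2)$ be this graph with, around each vertex, the edges in the cyclic order in which the tour uses them to leave that vertex, with the black half-edge of the edge $1$ as root, and with the set of edges consisting, for each vertex other than the black vertex $c_1(1)$, of the last edge used by the tour to leave it. (1) For every composition $\delta$ of $n$ of length $\ell'=k+r$, the above defines a bijection $\Phi$ (Bernardi's bijection) from $B_{\gamma,\delta}$ to the set of $(\ell,\ell')$-labelled bipartite tree-rooted maps with $n$ edges such that the black (resp. white) vertex labelled $i$ has degree $\gamma_i$ (resp. $\delta_i$); in particular the given edges form a spanning tree. For every composition $\alpha$ of length $k$ and size $m\le n$, it extends to a bijection $\Psi$ from $T_{\gamma,\delta}^\alpha$ to the set of $\alpha$-marked $(\ell,\ell')$-labelled bipartite tree-rooted maps with $n$ edges such that the black (resp. white) vertex labelled $i$ has degree $\gamma_i$ (resp. $\delta_i$): $\Psi(\pi,A,c_1,c_2)$ is the map $\Phi(\pi,c_1,c_2)$ in which the edges in $A_1\cup\dots\cup A_k$ are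 marked. In particular, forgetting the marks of $\Psi(\pi,A,c_1,c_2)$ gives $\Phi(\pi,c_1,c_2)$. (2) If $\alpha$ and $\beta$ are compositions of the same size $m\le n$ and the same length $k$, then $\#T_\gamma^\alpha(r)=\#T_\gamma^\beta(r)$. -/

import Mathlib

/-!
Throughout, `[n]` is modelled by `Fin n`, so that the element `1` of `[n]` is `0 : Fin n`
and the `n`-cycle `(1, 2, ..., n)` is `finRotate n`.
-/

namespace SepMaps

/-- The tuple `α` is a composition of size `n`: positive integers summing to `n`. -/
structure IsComposition {k : ℕ} (α : Fin k → ℕ) (n : ℕ) : Prop where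
  pos : ∀ i, 0 < α i
  sum_eq : ∑ i, α i = n

/-! ### Colored factorizations -/

/-- `c` is a cycle coloring of `π` in `[q]`: it is constant on every cycle of `π`. -/
def IsCycleColoring {n q : ℕ} (π : Equiv.Perm (Fin n)) (c : Fin n → Fin q) : Prop :=
  ∀ i j, π.SameCycle i j → c i = c j

/-- The number of elements colored `i`. -/
def colorCount {n q : ℕ} (c : Fin n → Fin q) (i : Fin q) : ℕ :=
  (Finset.univ.filter fun e => c e = i).card

/-- The product `π ∘ (1, 2, ..., n)`. -/
def prodCycle {n : ℕ} (π : Equiv.Perm (Fin n)) : Equiv.Perm (Fin n) := π * finRotate n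

/-- The set of tuples of `k` pairwise disjoint subsets of `[n]` of cardinalities
`α 1, ..., α k`. -/
def disjointTuples (n : ℕ) {k : ℕ} (α : Fin k → ℕ) : Set (Fin k → Finset (Fin n)) :=
  {A | (∀ i j, i ≠ j → Disjoint (A i) (A j)) ∧ ∀ i, (A i).card = α i}

/-- The set `B_{γ,δ}` of colored factorizations: triples `(π, c₁, c₂)`. -/
def coloredFactorizations (n : ℕ) {l l' : ℕ} (γ : Fin l → ℕ) (δ : Fin l' → ℕ) :
    Set (Equiv.Perm (Fin n) × (Fin n → Fin l) × (Fin n → Fin l')) :=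
  {x | (IsCycleColoring x.1 x.2.1 ∧ ∀ i, colorCount x.2.1 i = γ i) ∧
    (IsCycleColoring (prodCycle x.1) x.2.2 ∧ ∀ i, colorCount x.2.2 i = δ i)}

/-- The set `T_γ^α(r)` of separated colored factorizations: quadruples `(π, A, c₁, c₂)`. -/
def separatedFactorizations (n : ℕ) {l k : ℕ} (γ : Fin l → ℕ) (α : Fin k → ℕ) (r : ℕ) :
    Set (Equiv.Perm (Fin n) × (Fin k → Finset (Fin n)) ×
      (Fin n → Fin l) × (Fin n → Fin (k + r))) :=
  {x | x.2.1 ∈ disjointTuples n α ∧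
    (IsCycleColoring x.1 x.2.2.1 ∧ ∀ i, colorCount x.2.2.1 i = γ i) ∧
    (IsCycleColoring (prodCycle x.1) x.2.2.2 ∧ Function.Surjective x.2.2.2 ∧
      ∀ i, ∀ e ∈ x.2.1 i, x.2.2.2 e = Fin.castAdd r i)}

/-- The set `T_{γ,δ}^α`: the elements of `T_γ^α(r)` such that `δ i` elements have
`c₂`-color `i`, for all `i`. -/
def separatedFactorizationsWith (n : ℕ) {l k r : ℕ} (γ : Fin l → ℕ) (δ : Fin (k + r) → ℕ)
    (α : Fin k → ℕ) :
    Set (Equiv.Perm (Fin n) × (Fin k → Finset (Fin n)) ×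
      (Fin n → Fin l) × (Fin n → Fin (k + r))) :=
  {x | x ∈ separatedFactorizations n γ α r ∧ ∀ i, colorCount x.2.2.2 i = δ i}

/-- Forgetting `A` maps `T_{γ,δ}^α` to `B_{γ,δ}`. -/
def forgetSets {n l k r : ℕ} {γ : Fin l → ℕ} {δ : Fin (k + r) → ℕ} {α : Fin k → ℕ}
    (x : separatedFactorizationsWith n γ δ α) : coloredFactorizations n γ δ :=
  ⟨(x.1.1, x.1.2.2), x.2.1.2.1, x.2.1.2.2.1, x.2.2⟩

/-! ### Bipartite tree-rooted maps

Maps on orientable surfaces are represented by rotation systems of connected multigraphs.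
In a bipartite graph every edge has one black and one white half-edge, so a cyclic ordering of
the half-edges around each black (resp. white) vertex is a permutation of the edges whose cycles
are the sets of edges incident to a common black (resp. white) vertex. The black and white
vertices of an `(l, l')`-labelled map are identified with their labels in `[l]` and `[l']`. The
edges are first given names in `Fin n`; the names are removed below by passing to isomorphism
classes. -/

/-- The simple graph on the black and white vertices in which two vertices are adjacent if they
are joined by an edge of the set `S`; `b` and `w` give the black and white ends of the edges. -/
def edgeGraph {n l l' : ℕ} (b : Fin n → Fin l) (w : Fin n → Fin l') (S : Set (Fin n)) :
    SimpleGraph (Fin l ⊕ Fin l') :=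
  SimpleGraph.fromEdgeSet ((fun e => s(Sum.inl (b e), Sum.inr (w e))) '' S)

/-- A rooted `(l, l')`-labelled bipartite map with edge set `Fin n`. The root half-edge is
incident to a black vertex, hence it is determined by the edge `root` containing it. -/
structure RootedBipartiteMap (n l l' : ℕ) where
  blackEnd : Fin n → Fin l
  whiteEnd : Fin n → Fin l'
  blackRot : Equiv.Perm (Fin n)
  whiteRot : Equiv.Perm (Fin n)
  blackRot_sameCycle : ∀ e f, blackRot.SameCycle e f ↔ blackEnd e = blackEnd f
  whiteRot_sameCycle : ∀ e f, whiteRot.SameCycle e f ↔ whiteEnd e = whiteEnd f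
  connected : (edgeGraph blackEnd whiteEnd Set.univ).Connected
  root : Fin n

/-- A tree-rooted map: a rooted map with a marked spanning tree, given by its set of edges.
Since multiple edges are allowed, a set of edges forms a spanning tree if it contains no two
parallel edges and the simple graph that it induces on all the vertices is a tree. -/
structure TreeRootedMap (n l l' : ℕ) extends RootedBipartiteMap n l l' where
  tree : Finset (Fin n)
  tree_injOn : Set.InjOn (fun e => (blackEnd e, whiteEnd e)) (tree : Set (Fin n))
  tree_isTree : (edgeGraph blackEnd whiteEnd (tree : Set (Fin n))).IsTree

namespace TreeRootedMap

variable {n l l' : ℕ}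

/-- The black (resp. white) vertex labelled `i` has degree `γ i` (resp. `δ i`). -/
def HasDegrees (M : TreeRootedMap n l l') (γ : Fin l → ℕ) (δ : Fin l' → ℕ) : Prop :=
  (∀ i, (Finset.univ.filter fun e => M.blackEnd e = i).card = γ i) ∧
    ∀ i, (Finset.univ.filter fun e => M.whiteEnd e = i).card = δ i

/-- The set `X` of marked edges makes the map `α`-marked: `α i` marked edges are incident to the
white vertex labelled `i` for `i ∈ [k]`, and there are no other marked edges. -/
def IsMarking {k r : ℕ} (M : TreeRootedMap n l (k + r)) (α : Fin k → ℕ)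
    (X : Finset (Fin n)) : Prop :=
  (∀ i : Fin k, (X.filter fun e => M.whiteEnd e = Fin.castAdd r i).card = α i) ∧
    ∀ e ∈ X, ∃ i : Fin k, M.whiteEnd e = Fin.castAdd r i

/-- The bijection `φ` between the edges is an isomorphism of labelled tree-rooted maps. -/
structure IsIso (φ : Equiv.Perm (Fin n)) (M N : TreeRootedMap n l l') : Prop where
  blackEnd : ∀ e, N.blackEnd (φ e) = M.blackEnd e
  whiteEnd : ∀ e, N.whiteEnd (φ e) = M.whiteEnd e
  blackRot : ∀ e, N.blackRot (φ e) = φ (M.blackRot e)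
  whiteRot : ∀ e, N.whiteRot (φ e) = φ (M.whiteRot e)
  root : N.root = φ M.root
  tree : ∀ e, φ e ∈ N.tree ↔ e ∈ M.tree

theorem IsIso.refl (M : TreeRootedMap n l l') : IsIso 1 M M :=
  ⟨fun _ => rfl, fun _ => rfl, fun _ => rfl, fun _ => rfl, rfl, fun _ => Iff.rfl⟩

theorem IsIso.symm {φ : Equiv.Perm (Fin n)} {M N : TreeRootedMap n l l'} (h : IsIso φ M N) :
    IsIso φ.symm N M where
  blackEnd e := by rw [← h.blackEnd, Equiv.apply_symm_apply]
  whiteEnd e := by rw [← h.whiteEnd, Equiv.apply_symm_apply]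
  blackRot e := by
    apply φ.injective
    rw [← h.blackRot, Equiv.apply_symm_apply, Equiv.apply_symm_apply]
  whiteRot e := by
    apply φ.injective
    rw [← h.whiteRot, Equiv.apply_symm_apply, Equiv.apply_symm_apply]
  root := by rw [h.root, Equiv.symm_apply_apply]
  tree e := by rw [← h.tree, Equiv.apply_symm_apply]

theorem IsIso.trans {φ ψ : Equiv.Perm (Fin n)} {M N P : TreeRootedMap n l l'}
    (h : IsIso φ M N) (h' : IsIso ψ N P) : IsIso (ψ * φ) M P where
  blackEnd e := by rw [Equiv.Perm.mul_apply, h'.blackEnd, h.blackEnd]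
  whiteEnd e := by rw [Equiv.Perm.mul_apply, h'.whiteEnd, h.whiteEnd]
  blackRot e := by rw [Equiv.Perm.mul_apply, h'.blackRot, h.blackRot, Equiv.Perm.mul_apply]
  whiteRot e := by rw [Equiv.Perm.mul_apply, h'.whiteRot, h.whiteRot, Equiv.Perm.mul_apply]
  root := by rw [Equiv.Perm.mul_apply, h'.root, h.root]
  tree e := by rw [Equiv.Perm.mul_apply, h'.tree, h.tree]

end TreeRootedMap

/-- Isomorphism of labelled tree-rooted maps with prescribed degrees. -/
def treeRootedSetoid (n : ℕ) {l l' : ℕ} (γ : Fin l → ℕ) (δ : Fin l' → ℕ) :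
    Setoid {M : TreeRootedMap n l l' // M.HasDegrees γ δ} where
  r M N := ∃ φ, TreeRootedMap.IsIso φ M.1 N.1
  iseqv :=
    ⟨fun M => ⟨1, .refl M.1⟩, fun ⟨φ, h⟩ => ⟨φ.symm, h.symm⟩,
      fun ⟨φ, h⟩ ⟨ψ, h'⟩ => ⟨ψ * φ, h.trans h'⟩⟩

/-- The set of `(l, l')`-labelled bipartite tree-rooted maps with `n` edges such that the black
(resp. white) vertex labelled `i` has degree `γ i` (resp. `δ i`). -/
def TreeRootedMaps (n : ℕ) {l l' : ℕ} (γ : Fin l → ℕ) (δ : Fin l' → ℕ) : Type :=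
  Quotient (treeRootedSetoid n γ δ)

/-- Isomorphism of `α`-marked labelled tree-rooted maps with prescribed degrees. -/
def markedSetoid (n : ℕ) {l k r : ℕ} (γ : Fin l → ℕ) (δ : Fin (k + r) → ℕ) (α : Fin k → ℕ) :
    Setoid {P : TreeRootedMap n l (k + r) × Finset (Fin n) //
      P.1.HasDegrees γ δ ∧ P.1.IsMarking α P.2} where
  r P Q := ∃ φ, TreeRootedMap.IsIso φ P.1.1 Q.1.1 ∧ ∀ e, φ e ∈ Q.1.2 ↔ e ∈ P.1.2
  iseqv :=
    ⟨fun P => ⟨1, .refl P.1.1, fun _ => Iff.rfl⟩,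
      fun ⟨φ, h, hX⟩ => ⟨φ.symm, h.symm, fun e => by rw [← hX, Equiv.apply_symm_apply]⟩,
      fun ⟨φ, h, hX⟩ ⟨ψ, h', hX'⟩ =>
        ⟨ψ * φ, h.trans h', fun e => by rw [Equiv.Perm.mul_apply, hX', hX]⟩⟩

/-- The set of `α`-marked `(l, k + r)`-labelled bipartite tree-rooted maps with `n` edges such
that the black (resp. white) vertex labelled `i` has degree `γ i` (resp. `δ i`). -/
def MarkedTreeRootedMaps (n : ℕ) {l k r : ℕ} (γ : Fin l → ℕ) (δ : Fin (k + r) → ℕ)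
    (α : Fin k → ℕ) : Type :=
  Quotient (markedSetoid n γ δ α)

/-- Forgetting the marks. -/
def forgetMarks {n l k r : ℕ} {γ : Fin l → ℕ} {δ : Fin (k + r) → ℕ} {α : Fin k → ℕ} :
    MarkedTreeRootedMaps n γ δ α → TreeRootedMaps n γ δ :=
  Quotient.map' (s₁ := markedSetoid n γ δ α) (s₂ := treeRootedSetoid n γ δ)
    (fun P => ⟨P.1.1, P.2.1⟩) fun _ _ ⟨φ, h, _⟩ => ⟨φ, h⟩

/-! ### Bernardi's bijection

Let `(π, c₁, c₂)` be a colored factorization and let `σ = π ∘ (1, 2, ..., n)`. View every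
`t ∈ [n]` as an edge joining the black vertex `c₁ t` to the white vertex `c₂ t`. The tour of the
face of the one-face map encoded by `π` follows, for `t = 1, ..., n`, the edge `t` from black to
white and then the edge `σ t` from white to black; this is possible since
`c₂ (σ t) = c₂ t` and `c₁ (σ t) = c₁ (t + 1)` (indices modulo `n`). So each edge is followed
once in each direction, and the edge `e` is used to leave its black end at time `e` and its white
end at time `σ⁻¹ e`. The tree-rooted map associated with `(π, c₁, c₂)` has the following
structure: around each vertex the edges are in the cyclic order in which the tour uses them to
leave this vertex; the root is the first edge of the tour; and the tree consists of the last edge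
used to leave each vertex other than the starting point of the tour. -/

/-- The permutation `ρ` maps each edge `e` to the edge that is used, after `e`, to leave the same
vertex `v e`, where `time` gives the times at which the edges are used; the last one is mapped to
the first one. -/
def IsExitOrder {n q : ℕ} (time : Fin n → Fin n) (v : Fin n → Fin q)
    (ρ : Equiv.Perm (Fin n)) : Prop :=
  ∀ e, v (ρ e) = v e ∧
    ((time e < time (ρ e) ∧ ∀ f, v f = v e → time e < time f → time (ρ e) ≤ time f) ∨
      ∀ f, v f = v e → time (ρ e) ≤ time f ∧ time f ≤ time e)

/-- The edge `e` is the last one used to leave the vertex `v e`. -/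
def IsLastExit {n q : ℕ} (time : Fin n → Fin n) (v : Fin n → Fin q) (e : Fin n) : Prop :=
  ∀ f, v f = v e → time f ≤ time e

/-- `M` is the tree-rooted map that Bernardi's bijection associates with `(π, c₁, c₂)`, with its
edges named by the times at which the tour uses them to leave a black vertex. -/
structure IsBernardiMap {n l l' : ℕ}
    (x : Equiv.Perm (Fin n) × (Fin n → Fin l) × (Fin n → Fin l'))
    (M : TreeRootedMap n l l') : Prop where
  blackEnd : M.blackEnd = x.2.1
  whiteEnd : M.whiteEnd = x.2.2
  blackRot : IsExitOrder id x.2.1 M.blackRot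
  whiteRot : IsExitOrder (prodCycle x.1).symm x.2.2 M.whiteRot
  root : (M.root : ℕ) = 0
  tree : ∀ e, e ∈ M.tree ↔
    (x.2.1 e ≠ x.2.1 M.root ∧ IsLastExit id x.2.1 e) ∨
      IsLastExit (prodCycle x.1).symm x.2.2 e

end SepMaps

/-! Replace every edge of a bipartite graph by two opposite arcs. The digraph so obtained is
balanced, and a colored factorization is one of its Eulerian circuits, in which the edge that leaves
a black vertex at time `t` is named `t`. Part (1) is then the correspondence behind the BEST
theorem. Along an Eulerian circuit the last exits point to vertices whose own last exit is later, so
they form a spanning tree directed to the starting vertex (`IsTour.rooted`, `Rooted.isTree`).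
Conversely, order the arcs that leave each vertex so that the last ones lead to a vertex `β`. The
walk from `β` that always takes the first unused arc gets stuck only at `β`, and by then it has used
every arc (`exists_isTour`).

A tree-rooted map provides exactly such orders. Direct its tree to the root vertex and cut the
cyclic order around every other vertex after the tree edge to its parent; around the root vertex,
cut it just before the root. The greedy tour of these orders gives surjectivity
(`exists_isIso_isBernardiMap`). An isomorphism respects rotations, root and tree, hence last exits,
hence orders, hence tours, which gives injectivity (`IsBernardiMap.eq_of_isIso`). Marks are carried
along: the marked edges together with `c₂` determine the sets `A i`.

For part (2), the number of colored factorizations depends on `δ` only through its length. Fix the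
half-edges around each vertex, with one of them designated as last. Colored factorizations then
correspond to pairs of a starting black vertex and a matching of black with white half-edges whose
last exits lead to that vertex (`ncard_coloredFactorizations`). When one half-edge that is not last
moves from a white vertex to another, some matchings stop being rooted and others become so.
Exchanging the partners of the last half-edges of these two vertices injects each kind into the
other (`Rooted.exchange`), so the count is unchanged.

Finally, each colored factorization extends to a separated one in `∏ i, (δ i).choose (α i)` ways.
Summed over `δ`, this product is a coefficient of `∏ i, X ^ α i / (1 - X) ^ (α i + 1)` times `(X /
(1 - X)) ^ r`, which involves `α` only through its size and length. -/

/-! ### Greedy walks in balanced digraphs -/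

namespace SepMaps

/-- Following the function `p` from any vertex leads to `r`. -/
def Rooted {V : Type*} (r : V) (p : V → V) : Prop :=
  ∀ v, Relation.ReflTransGen (fun a c => a ≠ r ∧ p a = c) v r

/-- The first `j` values of `s` are the arcs of a walk from `v₀` in the digraph with arcs `D`
that uses no arc twice and leaves every vertex through its arcs in the order given by `ord`. -/
structure IsGreedyWalk {V D : Type*} (src tgt : D → V) (ord : D → ℕ) (v₀ : V) (s : ℕ → D)
    (j : ℕ) : Prop where
  start : 0 < j → src (s 0) = v₀
  chain : ∀ i, i + 1 < j → src (s (i + 1)) = tgt (s i)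
  inj : ∀ i < j, ∀ i' < j, s i = s i' → i = i'
  greedy : ∀ i < j, ∀ d, src d = src (s i) → ord d < ord (s i) → ∃ i' < i, s i' = d

/-- The vertex reached by the first `j` arcs of `s`. -/
def walkEnd {V D : Type*} (tgt : D → V) (v₀ : V) (s : ℕ → D) : ℕ → V
  | 0 => v₀
  | j + 1 => tgt (s j)

namespace IsGreedyWalk

variable {V D : Type*} {src tgt : D → V} {ord : D → ℕ} {v₀ : V} {s : ℕ → D} {j : ℕ}

theorem mono (h : IsGreedyWalk src tgt ord v₀ s j) {i : ℕ} (hi : i ≤ j) :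
    IsGreedyWalk src tgt ord v₀ s i where
  start h0 := h.start (by omega)
  chain a ha := h.chain a (by omega)
  inj a ha c hc := h.inj a (by omega) c (by omega)
  greedy a ha := h.greedy a (by omega)

theorem src_eq (h : IsGreedyWalk src tgt ord v₀ s j) {i : ℕ} (hi : i < j) :
    src (s i) = walkEnd tgt v₀ s i := by
  cases i with
  | zero => exact h.start hi
  | succ i => exact h.chain i hi

/-- Flow conservation: a walk leaves a vertex as often as it enters it, up to corrections at its two
ends. -/
theorem sum_src_add [DecidableEq V] (h : IsGreedyWalk src tgt ord v₀ s j) (v : V) :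
    (∑ i ∈ Finset.range j, if src (s i) = v then 1 else 0) +
        (if walkEnd tgt v₀ s j = v then 1 else 0) =
      (∑ i ∈ Finset.range j, if tgt (s i) = v then 1 else 0) + if v₀ = v then 1 else 0 := by
  induction j with
  | zero => rfl
  | succ j ih =>
    have := ih (h.mono (Nat.le_succ j))
    rw [Finset.sum_range_succ, Finset.sum_range_succ, h.src_eq (Nat.lt_succ_self j)]
    change _ + (if tgt (s j) = v then 1 else 0) = _
    omega

theorem sum_eq_card [DecidableEq V] [DecidableEq D] (h : IsGreedyWalk src tgt ord v₀ s j) [Fintype D] (f : D → V) (v : V) :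
    (∑ i ∈ Finset.range j, if f (s i) = v then 1 else 0) =
      (Finset.univ.filter fun d => f d = v ∧ ∃ i < j, s i = d).card := by
  rw [← Finset.card_filter]
  refine Finset.card_bij (fun i _ => s i) ?_ ?_ ?_
  · intro i hi
    simp only [Finset.mem_filter, Finset.mem_range, Finset.mem_univ, true_and] at hi ⊢
    exact ⟨hi.2, i, hi.1, rfl⟩
  · intro i hi i' hi'
    simp only [Finset.mem_filter, Finset.mem_range] at hi hi'
    exact h.inj i hi.1 i' hi'.1
  · intro d hd
    simp only [Finset.mem_filter, Finset.mem_range, Finset.mem_univ, true_and] at hd ⊢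
    obtain ⟨hd, i, hi, rfl⟩ := hd
    exact ⟨i, ⟨hi, hd⟩, rfl⟩

/-- If the digraph is balanced and a greedy walk is stuck, then it returned to its start, and
the arcs that enter a vertex are all used as soon as those that leave it are. -/
theorem used_of_stuck [DecidableEq V] [DecidableEq D] [Fintype D] (h : IsGreedyWalk src tgt ord v₀ s j)
    (hbal : ∀ v, (Finset.univ.filter fun d => src d = v).card =
      (Finset.univ.filter fun d => tgt d = v).card)
    (hstuck : ∀ d, src d = walkEnd tgt v₀ s j → ∃ i < j, s i = d) :
    walkEnd tgt v₀ s j = v₀ ∧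
      ∀ v, (∀ d, src d = v → ∃ i < j, s i = d) → ∀ d, tgt d = v → ∃ i < j, s i = d := by
  -- At a vertex whose outgoing arcs are all used, balance turns the number of departures into the
  -- full in-degree.
  have key : ∀ v, (∀ d, src d = v → ∃ i < j, s i = d) →
      (Finset.univ.filter fun d => tgt d = v).card + (if walkEnd tgt v₀ s j = v then 1 else 0) =
        (Finset.univ.filter fun d => tgt d = v ∧ ∃ i < j, s i = d).card +
          if v₀ = v then 1 else 0 := by
    intro v hv
    have := h.sum_src_add v
    rw [h.sum_eq_card, h.sum_eq_card] at this
    rw [← this, ← hbal]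
    congr 2
    ext d
    simp only [Finset.mem_filter, Finset.mem_univ, true_and]
    exact ⟨fun hd => ⟨hd, hv d hd⟩, fun hd => hd.1⟩
  have hle : ∀ v, (Finset.univ.filter fun d => tgt d = v ∧ ∃ i < j, s i = d) ⊆
      Finset.univ.filter fun d => tgt d = v := by
    intro v d
    simp only [Finset.mem_filter, Finset.mem_univ, true_and]
    exact fun hd => hd.1
  have hend : walkEnd tgt v₀ s j = v₀ := by
    have h1 := key _ hstuck
    have h2 := Finset.card_le_card (hle (walkEnd tgt v₀ s j))
    by_contra hne
    rw [if_pos rfl, if_neg (Ne.symm hne)] at h1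
    omega
  refine ⟨hend, fun v hv d hd => ?_⟩
  have h1 := key v hv
  rw [hend] at h1
  have h2 := Finset.eq_of_subset_of_card_le (hle v) (by omega)
  have : d ∈ Finset.univ.filter fun d => tgt d = v := by simpa using hd
  rw [← h2] at this
  exact (Finset.mem_filter.1 this).2.2

/-- If the last exits lead to the start, then a stuck greedy walk used all the arcs. -/
theorem all_used_of_stuck [DecidableEq V] [DecidableEq D] [Fintype D] (h : IsGreedyWalk src tgt ord v₀ s j)
    (hbal : ∀ v, (Finset.univ.filter fun d => src d = v).card =
      (Finset.univ.filter fun d => tgt d = v).card)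
    (hord : ∀ d d', src d = src d' → ord d = ord d' → d = d')
    (last : V → D) (hlast : ∀ v, src (last v) = v) (hmax : ∀ d, ord d ≤ ord (last (src d)))
    (hroot : Rooted v₀ fun v => tgt (last v))
    (hstuck : ∀ d, src d = walkEnd tgt v₀ s j → ∃ i < j, s i = d) (d : D) :
    ∃ i < j, s i = d := by
  obtain ⟨hend, hin⟩ := h.used_of_stuck hbal hstuck
  -- Exhaustion spreads from `v₀` backwards along the last exits: if the parent of `v` is exhausted,
  -- all its incoming arcs are used, among them the last exit of `v`, and a greedy walk takes that
  -- one only after the other arcs leaving `v`.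
  have : ∀ v, ∀ d, src d = v → ∃ i < j, s i = d := by
    intro v
    induction hroot v using Relation.ReflTransGen.head_induction_on with
    | refl => exact fun d hd => hstuck d (hd.trans hend.symm)
    | head hac _ ih =>
      intro d hd
      obtain ⟨i, hi, hs⟩ := hin _ ih (last _) hac.2
      by_cases hdl : ord d = ord (last (src d))
      · exact ⟨i, hi, by rw [hs, hord d _ (hlast _).symm hdl, hd]⟩
      · have hlt : ord d < ord (s i) := by
          rw [hs, ← hd]
          exact lt_of_le_of_ne (hmax d) hdl
        obtain ⟨i', hi', hs'⟩ := h.greedy i hi d (by rw [hs, hlast, hd]) hlt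
        exact ⟨i', hi'.trans hi, hs'⟩
  exact this _ d rfl

/-- A greedy walk can be extended by the first unused arc that leaves its end. -/
theorem extend (h : IsGreedyWalk src tgt ord v₀ s j) {d : D}
    (hd : src d = walkEnd tgt v₀ s j) (hnew : ∀ i < j, s i ≠ d)
    (hmin : ∀ d', src d' = src d → ord d' < ord d → ∃ i < j, s i = d') :
    IsGreedyWalk src tgt ord v₀ (Function.update s j d) (j + 1) := by
  have hs : ∀ i < j, Function.update s j d i = s i := fun i hi =>
    Function.update_of_ne hi.ne _ _
  refine ⟨fun _ => ?_, fun i hi => ?_, fun i hi i' hi' heq => ?_, fun i hi e he hlt => ?_⟩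
  · rcases Nat.eq_zero_or_pos j with rfl | hj
    · simpa [walkEnd] using hd
    · rw [hs 0 hj, h.start hj]
  · rw [hs i (by omega)]
    rcases (Nat.lt_succ_iff.1 hi).lt_or_eq with hi | rfl
    · rw [hs _ hi, h.chain i hi]
    · rw [Function.update_self, hd, walkEnd]
  · rcases (Nat.lt_succ_iff.1 hi).lt_or_eq with hi | rfl <;>
      rcases (Nat.lt_succ_iff.1 hi').lt_or_eq with hi' | rfl
    · rw [hs i hi, hs i' hi'] at heq
      exact h.inj i hi i' hi' heq
    · rw [hs i hi, Function.update_self] at heq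
      exact absurd heq (hnew i hi)
    · rw [hs i' hi', Function.update_self] at heq
      exact absurd heq.symm (hnew i' hi')
    · rfl
  · rcases (Nat.lt_succ_iff.1 hi).lt_or_eq with hi | rfl
    · rw [hs i hi] at he hlt
      obtain ⟨i', hi', rfl⟩ := h.greedy i hi e he hlt
      exact ⟨i', hi', hs i' (hi'.trans hi)⟩
    · rw [Function.update_self] at he hlt
      obtain ⟨i', hi', rfl⟩ := hmin e he hlt
      exact ⟨i', hi', hs i' hi'⟩

/-- If the later arc came first in the order, greediness would place it before the earlier one, so
it would be used twice. -/
theorem lt_of_lt (h : IsGreedyWalk src tgt ord v₀ s j)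
    (hord : ∀ d d', src d = src d' → ord d = ord d' → d = d') {i i' : ℕ} (hi : i < i')
    (hi' : i' < j) (hsrc : src (s i) = src (s i')) : ord (s i) < ord (s i') := by
  rcases lt_trichotomy (ord (s i)) (ord (s i')) with hlt | heq | hlt
  · exact hlt
  · exact absurd (h.inj _ (hi.trans hi') _ hi' (hord _ _ hsrc heq)) hi.ne
  · obtain ⟨a, ha, hsa⟩ := h.greedy i (hi.trans hi') _ hsrc.symm hlt
    have := h.inj _ (by omega) _ hi' hsa
    omega

end IsGreedyWalk

/-- In a balanced digraph whose last exits lead to `v₀`, there is a greedy walk from `v₀` that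
uses all the arcs. -/
theorem exists_isGreedyWalk {V D : Type*} [DecidableEq V] [Fintype D] [Nonempty D]
    {src tgt : D → V} {ord : D → ℕ} {v₀ : V}
    (hbal : ∀ v, (Finset.univ.filter fun d => src d = v).card =
      (Finset.univ.filter fun d => tgt d = v).card)
    (hord : ∀ d d', src d = src d' → ord d = ord d' → d = d')
    (last : V → D) (hlast : ∀ v, src (last v) = v) (hmax : ∀ d, ord d ≤ ord (last (src d)))
    (hroot : Rooted v₀ fun v => tgt (last v)) :
    ∃ s, IsGreedyWalk src tgt ord v₀ s (Fintype.card D) ∧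
      walkEnd tgt v₀ s (Fintype.card D) = v₀ := by
  classical
  have main : ∀ j ≤ Fintype.card D, ∃ s, IsGreedyWalk src tgt ord v₀ s j := by
    intro j
    induction j with
    | zero =>
      refine fun _ => ⟨fun _ => Classical.arbitrary D, ?_, ?_, ?_, ?_⟩ <;> intros <;> omega
    | succ j ih =>
      intro hj
      obtain ⟨s, hs⟩ := ih (by omega)
      by_cases hstuck : ∀ d, src d = walkEnd tgt v₀ s j → ∃ i < j, s i = d
      · have hall := hs.all_used_of_stuck hbal hord last hlast hmax hroot hstuck
        have : Fintype.card D ≤ j := by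
          have hsurj : Function.Surjective fun i : Fin j => s i := fun d =>
            let ⟨i, hi, hd⟩ := hall d
            ⟨⟨i, hi⟩, hd⟩
          simpa using Fintype.card_le_of_surjective _ hsurj
        omega
      · push Not at hstuck
        obtain ⟨d, hd, hmin⟩ := (Set.toFinite
          {d | src d = walkEnd tgt v₀ s j ∧ ∀ i < j, s i ≠ d}).exists_minimalFor ord _ hstuck
        refine ⟨_, hs.extend hd.1 hd.2 fun d' hd' hlt => ?_⟩
        by_contra hcon
        push Not at hcon
        have := hmin (show d' ∈ {d | src d = walkEnd tgt v₀ s j ∧ ∀ i < j, s i ≠ d} from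
          ⟨hd'.trans hd.1, hcon⟩) hlt.le
        omega
  obtain ⟨s, hs⟩ := main _ le_rfl
  refine ⟨s, hs, (hs.used_of_stuck hbal fun d _ => ?_).1⟩
  have hinj : Function.Injective fun i : Fin (Fintype.card D) => s i := fun i i' h =>
    Fin.ext (hs.inj _ i.2 _ i'.2 h)
  obtain ⟨i, hi⟩ := ((Fintype.bijective_iff_injective_and_card _).2 ⟨hinj, by simp⟩).2 d
  exact ⟨i, i.2, hi⟩

end SepMaps

/-! ### Tours of bipartite graphs -/

namespace SepMaps

/-- The function that maps each vertex `v` of a bipartite graph to the other end of the edge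
`pe v` incident to it. -/
def parent {n l l' : ℕ} (b : Fin n → Fin l) (w : Fin n → Fin l') (pe : Fin l ⊕ Fin l' → Fin n) :
    Fin l ⊕ Fin l' → Fin l ⊕ Fin l'
  | Sum.inl i => Sum.inr (w (pe (Sum.inl i)))
  | Sum.inr j => Sum.inl (b (pe (Sum.inr j)))

/-- The edge `pe v` is incident to the vertex `v`, for every `v`. -/
structure IsIncident {n l l' : ℕ} (b : Fin n → Fin l) (w : Fin n → Fin l')
    (pe : Fin l ⊕ Fin l' → Fin n) : Prop where
  black : ∀ i, b (pe (Sum.inl i)) = i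
  white : ∀ j, w (pe (Sum.inr j)) = j

/-- The edge `pe v` is the last one around the vertex `v`, for every `v`. -/
structure IsLast {n l l' : ℕ} (b : Fin n → Fin l) (w : Fin n → Fin l') (ob ow : Fin n → ℕ)
    (pe : Fin l ⊕ Fin l' → Fin n) : Prop extends IsIncident b w pe where
  black_le : ∀ e, ob e ≤ ob (pe (Sum.inl (b e)))
  white_le : ∀ e, ow e ≤ ow (pe (Sum.inr (w e)))

/-- The closed tour that follows successively, for `t = 0, ..., n - 1`, the edge `x t` from black
to white and the edge `y t` from white to black. The edges are used to leave the black (resp.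
white) vertices in the order given by `ob` (resp. `ow`). -/
structure IsTour {n l l' : ℕ} (b : Fin n → Fin l) (w : Fin n → Fin l') (ob ow : Fin n → ℕ)
    (x y : Equiv.Perm (Fin n)) : Prop where
  white_eq : ∀ t, w (y t) = w (x t)
  black_eq : ∀ t, b (y t) = b (x (finRotate n t))
  black_mono : ∀ s t, b (x s) = b (x t) → s < t → ob (x s) < ob (x t)
  white_mono : ∀ s t, w (y s) = w (y t) → s < t → ow (y s) < ow (y t)

variable {n l l' : ℕ} {b : Fin n → Fin l} {w : Fin n → Fin l'} {ob ow : Fin n → ℕ}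

theorem finRotate_val_of_lt {t : Fin n} (h : (t : ℕ) + 1 < n) :
    (finRotate n t : ℕ) = t + 1 := by
  obtain ⟨n, rfl⟩ : ∃ k, n = k + 1 := ⟨n - 1, by omega⟩
  rw [finRotate_apply, Fin.val_add_one_of_lt]
  rw [Fin.lt_def, Fin.val_last]
  omega

theorem finRotate_val_of_eq {t : Fin n} (h : (t : ℕ) + 1 = n) : (finRotate n t : ℕ) = 0 := by
  obtain ⟨n, rfl⟩ : ∃ k, n = k + 1 := ⟨n - 1, by omega⟩
  have : t = Fin.last n := Fin.ext (by rw [Fin.val_last]; omega)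
  rw [this, finRotate_last]
  rfl

/-- Two enumerations that list the elements of each color in increasing order agree at `t` if
they agree before `t` and have the same color at `t`. -/
theorem apply_eq_of_mono {q : ℕ} {v : Fin n → Fin q} {o : Fin n → ℕ} {z z' : Equiv.Perm (Fin n)}
    (hz : ∀ s t, v (z s) = v (z t) → s < t → o (z s) < o (z t))
    (hz' : ∀ s t, v (z' s) = v (z' t) → s < t → o (z' s) < o (z' t)) {t : Fin n}
    (hlt : ∀ s < t, z s = z' s) (hv : v (z t) = v (z' t)) : z t = z' t := by
  have aux : ∀ {z z' : Equiv.Perm (Fin n)}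
      (_ : ∀ s t, v (z' s) = v (z' t) → s < t → o (z' s) < o (z' t))
      (_ : ∀ s < t, z s = z' s), v (z t) = v (z' t) → z t ≠ z' t → o (z' t) < o (z t) := by
    intro z z' hz' hlt hv hne
    obtain ⟨s, hs⟩ := z'.surjective (z t)
    rw [← hs] at hv ⊢
    refine hz' t s hv.symm ?_
    rcases lt_trichotomy s t with hst | rfl | hst
    · exact absurd (z.injective ((hlt s hst).trans hs)) hst.ne
    · exact absurd hs.symm hne
    · exact hst
  by_contra hne
  exact lt_asymm (aux hz' hlt hv hne)
    (aux hz (fun s hs => (hlt s hs).symm) hv.symm (Ne.symm hne))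

/-- The sequence of colors determines the enumeration, since each color class is listed in
increasing order. -/
theorem perm_eq_of_mono {q : ℕ} {v : Fin n → Fin q} {o : Fin n → ℕ} {z z' : Equiv.Perm (Fin n)}
    (hz : ∀ s t, v (z s) = v (z t) → s < t → o (z s) < o (z t))
    (hz' : ∀ s t, v (z' s) = v (z' t) → s < t → o (z' s) < o (z' t))
    (hv : ∀ t, v (z t) = v (z' t)) : z = z' := by
  have main : ∀ k, ∀ t : Fin n, (t : ℕ) = k → z t = z' t := by
    intro k
    induction k using Nat.strong_induction_on with
    | _ k ih =>
      intro t ht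
      exact apply_eq_of_mono hz hz' (fun s hs => ih s (ht ▸ hs) s rfl) (hv t)
  exact Equiv.ext fun t => main t t rfl

/-- The tour is determined by its starting point and by the orders. -/
theorem IsTour.unique {x y x' y' : Equiv.Perm (Fin n)} (h : IsTour b w ob ow x y)
    (h' : IsTour b w ob ow x' y') (h0 : ∀ t : Fin n, (t : ℕ) = 0 → b (x t) = b (x' t)) :
    x = x' ∧ y = y' := by
  have main : ∀ k, ∀ t : Fin n, (t : ℕ) = k → x t = x' t ∧ y t = y' t := by
    intro k
    induction k using Nat.strong_induction_on with
    | _ k ih =>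
      intro t ht
      have hx : ∀ s < t, x s = x' s := fun s hs => (ih s (ht ▸ hs) s rfl).1
      have hy : ∀ s < t, y s = y' s := fun s hs => (ih s (ht ▸ hs) s rfl).2
      have hb : b (x t) = b (x' t) := by
        rcases Nat.eq_zero_or_pos (t : ℕ) with h00 | hpos
        · exact h0 t h00
        · have ht' := t.2
          have hrot : finRotate n ⟨t - 1, by omega⟩ = t := by
            apply Fin.ext
            rw [finRotate_val_of_lt] <;> simp only <;> omega
          rw [← hrot, ← h.black_eq, ← h'.black_eq, hy]
          rw [Fin.lt_def]
          simp only
          omega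
      have hxt := apply_eq_of_mono h.black_mono h'.black_mono hx hb
      refine ⟨hxt, apply_eq_of_mono h.white_mono h'.white_mono hy ?_⟩
      rw [h.white_eq, h'.white_eq, hxt]
  exact ⟨Equiv.ext fun t => (main t t rfl).1, Equiv.ext fun t => (main t t rfl).2⟩

/-- The last exits of a tour lead to its starting point. -/
theorem IsTour.rooted {x y : Equiv.Perm (Fin n)} (h : IsTour b w ob ow x y)
    {pe : Fin l ⊕ Fin l' → Fin n} (hpe : IsLast b w ob ow pe) {t₀ : Fin n} (ht₀ : (t₀ : ℕ) = 0) :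
    Rooted (Sum.inl (b (x t₀))) (parent b w pe) := by
  -- Following last exits moves forward in time: a black exit at time `t` reaches a white vertex
  -- whose last exit is at time `t` or later, and a white exit at time `t` reaches a black vertex
  -- whose last exit is later than `t`, or the start when `t = n - 1`.
  have main : ∀ k, ∀ t : Fin n, n - t ≤ k →
      (∀ i, pe (Sum.inl i) = x t → Relation.ReflTransGen
        (fun a c => a ≠ Sum.inl (b (x t₀)) ∧ parent b w pe a = c) (Sum.inl i)
          (Sum.inl (b (x t₀)))) ∧
      (∀ j, pe (Sum.inr j) = y t → Relation.ReflTransGen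
        (fun a c => a ≠ Sum.inl (b (x t₀)) ∧ parent b w pe a = c) (Sum.inr j)
          (Sum.inl (b (x t₀)))) := by
    intro k
    induction k with
    | zero => exact fun t ht => by have := t.2; omega
    | succ k ih =>
      intro t ht
      have hw : ∀ j, pe (Sum.inr j) = y t → Relation.ReflTransGen
          (fun a c => a ≠ Sum.inl (b (x t₀)) ∧ parent b w pe a = c) (Sum.inr j)
          (Sum.inl (b (x t₀))) := by
        intro j hj
        refine Relation.ReflTransGen.head ⟨Sum.inr_ne_inl, rfl⟩ ?_
        have hpar : parent b w pe (Sum.inr j) = Sum.inl (b (x (finRotate n t))) := by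
          rw [parent, hj, h.black_eq]
        rw [hpar]
        rcases (Nat.succ_le_of_lt t.2).lt_or_eq with hlt | heq
        · obtain ⟨t', ht'⟩ := x.surjective (pe (Sum.inl (b (x (finRotate n t)))))
          refine (ih t' ?_).1 _ ht'.symm
          have hle : finRotate n t ≤ t' := by
            by_contra! hcon
            have h1 := h.black_mono _ _ (by rw [ht', hpe.black]) hcon
            have h2 := hpe.black_le (x (finRotate n t))
            rw [ht'] at h1
            omega
          rw [Fin.le_def, finRotate_val_of_lt hlt] at hle
          omega
        · have : finRotate n t = t₀ := Fin.ext ((finRotate_val_of_eq heq).trans ht₀.symm)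
          rw [this]
      refine ⟨fun i hi => ?_, hw⟩
      by_cases hroot : (Sum.inl i : Fin l ⊕ Fin l') = Sum.inl (b (x t₀))
      · rw [hroot]
      refine Relation.ReflTransGen.head ⟨hroot, rfl⟩ ?_
      have hpar : parent b w pe (Sum.inl i) = Sum.inr (w (y t)) := by
        rw [parent, hi, h.white_eq]
      rw [hpar]
      obtain ⟨t', ht'⟩ := y.surjective (pe (Sum.inr (w (y t))))
      have hle : t ≤ t' := by
        by_contra! hcon
        have h1 := h.white_mono _ _ (by rw [ht', hpe.white]) hcon
        have h2 := hpe.white_le (y t)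
        rw [ht'] at h1
        omega
      rcases hle.lt_or_eq with hlt | rfl
      · refine (ih t' ?_).2 _ ht'.symm
        rw [Fin.lt_def] at hlt
        omega
      · exact hw _ ht'.symm
  rintro (i | j)
  · obtain ⟨t, ht⟩ := x.surjective (pe (Sum.inl i))
    exact (main _ t le_rfl).1 i ht.symm
  · obtain ⟨t, ht⟩ := y.surjective (pe (Sum.inr j))
    exact (main _ t le_rfl).2 j ht.symm

/-- If the last exits lead to `β`, then there is a tour that starts at `β`. -/
theorem exists_isTour (hob : ∀ e f, b e = b f → ob e = ob f → e = f)
    (how : ∀ e f, w e = w f → ow e = ow f → e = f) {pe : Fin l ⊕ Fin l' → Fin n}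
    (hpe : IsLast b w ob ow pe) {β : Fin l} (hroot : Rooted (Sum.inl β) (parent b w pe)) :
    ∃ x y, IsTour b w ob ow x y ∧ ∀ t : Fin n, (t : ℕ) = 0 → b (x t) = β := by
  -- The arc `Sum.inl e` follows `e` from black to white and `Sum.inr e` from white to black;
  -- swapping the two exchanges sources and targets, whence the balance.
  let src : Fin n ⊕ Fin n → Fin l ⊕ Fin l' := Sum.map b w
  let tgt : Fin n ⊕ Fin n → Fin l ⊕ Fin l' := fun d => Sum.map b w d.swap
  let ord : Fin n ⊕ Fin n → ℕ := Sum.elim ob ow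
  let last : Fin l ⊕ Fin l' → Fin n ⊕ Fin n :=
    Sum.elim (fun i => Sum.inl (pe (Sum.inl i))) fun j => Sum.inr (pe (Sum.inr j))
  have hn : 0 < n := (pe (Sum.inl β)).pos
  have : Nonempty (Fin n) := ⟨⟨0, hn⟩⟩
  have : Nonempty (Fin n ⊕ Fin n) := ⟨Sum.inl ⟨0, hn⟩⟩
  have hord : ∀ d d', src d = src d' → ord d = ord d' → d = d' := by
    rintro (d | d) (d' | d') h h'
    · rw [hob d d' (Sum.inl_injective h) h']
    · exact absurd h Sum.inl_ne_inr
    · exact absurd h Sum.inr_ne_inl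
    · rw [how d d' (Sum.inr_injective h) h']
  obtain ⟨s, hs, hend⟩ := exists_isGreedyWalk (src := src) (tgt := tgt) (ord := ord)
    (v₀ := Sum.inl β) (fun v => Finset.card_equiv (Equiv.sumComm _ _) (by simp [src, tgt])) hord
    last (by rintro (i | j); exacts [congrArg _ (hpe.black i), congrArg _ (hpe.white j)])
    (by rintro (e | e); exacts [hpe.black_le e, hpe.white_le e])
    (by
      convert hroot using 2 with v
      rcases v with i | j <;> rfl)
  have hcard : Fintype.card (Fin n ⊕ Fin n) = 2 * n := by simp [two_mul]
  rw [hcard] at hs hend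
  -- The walk alternates between the colors, so black exits occupy the even positions `2 * t` and
  -- white exits the odd positions `2 * t + 1`.
  have hodd : ∀ i, i + 1 < 2 * n → (∃ e, s i = Sum.inl e) → ∃ e, s (i + 1) = Sum.inr e := by
    rintro i hi ⟨e, he⟩
    have := hs.chain i hi
    rw [he] at this
    rcases hsi : s (i + 1) with d | d
    · rw [hsi] at this
      exact absurd this Sum.inl_ne_inr
    · exact ⟨d, rfl⟩
  have heven : ∀ t < n, ∃ e, s (2 * t) = Sum.inl e := by
    intro t
    induction t with
    | zero =>
      intro _
      have := hs.start (by omega)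
      rcases hsi : s 0 with d | d
      · exact ⟨d, rfl⟩
      · rw [hsi] at this
        exact absurd this Sum.inr_ne_inl
    | succ t ih =>
      intro ht
      obtain ⟨e, he⟩ := hodd _ (by omega) (ih (by omega))
      have := hs.chain (2 * t + 1) (by omega)
      rw [he] at this
      rcases hsi : s (2 * t + 1 + 1) with d | d
      · exact ⟨d, rfl⟩
      · rw [hsi] at this
        exact absurd this Sum.inr_ne_inl
  choose! X hX using heven
  have hY' : ∀ t < n, ∃ e, s (2 * t + 1) = Sum.inr e := fun t ht =>
    hodd _ (by omega) ⟨_, hX t ht⟩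
  choose! Y hY using hY'
  have hXinj : Function.Injective fun t : Fin n => X t := by
    intro t t' h
    have := hs.inj (2 * t) (by omega) (2 * t') (by omega) (by
      rw [hX t t.2, hX t' t'.2]
      exact congrArg Sum.inl h)
    exact Fin.ext (by omega)
  have hYinj : Function.Injective fun t : Fin n => Y t := by
    intro t t' h
    have := hs.inj (2 * t + 1) (by omega) (2 * t' + 1) (by omega)
      (by
        rw [hY t t.2, hY t' t'.2]
        exact congrArg Sum.inr h)
    exact Fin.ext (by omega)
  refine ⟨Equiv.ofBijective _ (Finite.injective_iff_bijective.1 hXinj),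
    Equiv.ofBijective _ (Finite.injective_iff_bijective.1 hYinj), ⟨?_, ?_, ?_, ?_⟩, ?_⟩
  · intro t
    have := hs.chain (2 * t) (by omega)
    rw [hX t t.2, hY t t.2] at this
    exact Sum.inr_injective this
  · intro t
    rcases (Nat.succ_le_of_lt t.2).lt_or_eq with hlt | heq
    · have := hs.chain (2 * t + 1) (by omega)
      rw [show 2 * (t : ℕ) + 1 + 1 = 2 * ((t : ℕ) + 1) by ring, hX _ hlt, hY t t.2] at this
      simp only [Equiv.ofBijective_apply, finRotate_val_of_lt hlt]
      exact (Sum.inl_injective this).symm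
    · rw [show 2 * n = 2 * (t : ℕ) + 1 + 1 by omega] at hend
      have h0 := hs.start (by omega)
      have hX0 := hX 0 hn
      rw [mul_zero] at hX0
      simp only [walkEnd, hY t t.2] at hend
      rw [hX0, ← hend] at h0
      simp only [Equiv.ofBijective_apply, finRotate_val_of_eq heq]
      exact (Sum.inl_injective h0).symm
  · intro t t' hb hlt
    have := hs.lt_of_lt hord (i := 2 * t) (i' := 2 * t') (by rw [Fin.lt_def] at hlt; omega)
      (by omega) (by rw [hX t t.2, hX t' t'.2]; exact congrArg Sum.inl hb)
    rwa [hX t t.2, hX t' t'.2] at this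
  · intro t t' hb hlt
    have := hs.lt_of_lt hord (i := 2 * t + 1) (i' := 2 * t' + 1)
      (by rw [Fin.lt_def] at hlt; omega) (by omega)
      (by rw [hY t t.2, hY t' t'.2]; exact congrArg Sum.inr hb)
    rwa [hY t t.2, hY t' t'.2] at this
  · intro t ht
    have h0 := hs.start (by omega)
    have hX0 := hX 0 hn
    rw [mul_zero] at hX0
    rw [hX0] at h0
    simp only [Equiv.ofBijective_apply, ht]
    exact Sum.inl_injective h0

end SepMaps

/-! ### Spanning trees and parent functions -/

namespace SepMaps

/-- Iterates on a cycle never leave it, whereas `r` has no outgoing step. -/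
theorem Rooted.not_reflTransGen {V : Type*} {r : V} {p : V → V} (h : Rooted r p) {a : V}
    (ha : a ≠ r) : ¬ Relation.ReflTransGen (fun a c => a ≠ r ∧ p a = c) (p a) a := by
  intro hcyc
  have main : ∀ c, Relation.ReflTransGen (fun a c => a ≠ r ∧ p a = c) a c →
      Relation.ReflTransGen (fun a c => a ≠ r ∧ p a = c) c a := by
    intro c hc
    induction hc with
    | refl => exact Relation.ReflTransGen.refl
    | tail _ hcd ih =>
      rcases ih.cases_head with rfl | ⟨d, hd, hda⟩
      · rw [← hcd.2]
        exact hcyc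
      · rw [← hcd.2, hd.2]
        exact hda
  rcases (main r (h a)).cases_head with hra | ⟨d, hd, _⟩
  · exact ha hra.symm
  · exact hd.1 rfl

variable {n l l' : ℕ} {b : Fin n → Fin l} {w : Fin n → Fin l'}

theorem edgeGraph_adj {S : Set (Fin n)} {u v : Fin l ⊕ Fin l'} :
    (edgeGraph b w S).Adj u v ↔ ∃ e ∈ S, s(Sum.inl (b e), Sum.inr (w e)) = s(u, v) := by
  rw [edgeGraph, SimpleGraph.fromEdgeSet_adj]
  refine ⟨fun h => h.1, fun h => ⟨h, ?_⟩⟩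
  obtain ⟨e, _, he⟩ := h
  rintro rfl
  rw [Sym2.eq_iff] at he
  rcases he with ⟨h1, h2⟩ | ⟨h1, h2⟩ <;> exact Sum.inl_ne_inr (h1.trans h2.symm)

theorem edgeSet_edgeGraph (T : Finset (Fin n)) :
    (edgeGraph b w (T : Set (Fin n))).edgeSet =
      (T.image fun e => s(Sum.inl (b e), Sum.inr (w e)) : Finset (Sym2 (Fin l ⊕ Fin l'))) := by
  ext z
  induction z using Sym2.ind with
  | _ u v =>
    rw [SimpleGraph.mem_edgeSet, edgeGraph_adj]
    simp

theorem card_edgeSet_edgeGraph (T : Finset (Fin n)) :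
    Nat.card (edgeGraph b w (T : Set (Fin n))).edgeSet =
      (T.image fun e => (s(Sum.inl (b e), Sum.inr (w e)) : Sym2 (Fin l ⊕ Fin l'))).card := by
  rw [edgeSet_edgeGraph, Nat.card_coe_set_eq, Set.ncard_coe_finset]

theorem edgeGraph_mono {S T : Set (Fin n)} (h : S ⊆ T) : edgeGraph b w S ≤ edgeGraph b w T := by
  intro u v huv
  rw [edgeGraph_adj] at huv ⊢
  obtain ⟨e, he, heq⟩ := huv
  exact ⟨e, h he, heq⟩

theorem IsIncident.ends_eq {pe : Fin l ⊕ Fin l' → Fin n} (h : IsIncident b w pe)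
    (v : Fin l ⊕ Fin l') :
    s(Sum.inl (b (pe v)), Sum.inr (w (pe v))) = s(v, parent b w pe v) := by
  rcases v with i | j
  · rw [parent, h.black]
  · rw [parent, h.white, Sym2.eq_swap]

theorem card_image_nonroot {pe : Fin l ⊕ Fin l' → Fin n} {r : Fin l ⊕ Fin l'}
    {T : Finset (Fin n)} (hT : ∀ e, e ∈ T ↔ ∃ v, v ≠ r ∧ pe v = e) :
    T = (Finset.univ.erase r).image pe := by
  ext e
  simp [hT]

/-- A parent function that leads to `r` defines a spanning tree. -/
theorem Rooted.isTree {pe : Fin l ⊕ Fin l' → Fin n} (hpe : IsIncident b w pe)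
    {r : Fin l ⊕ Fin l'} (hroot : Rooted r (parent b w pe)) {T : Finset (Fin n)}
    (hT : ∀ e, e ∈ T ↔ ∃ v, v ≠ r ∧ pe v = e) :
    Set.InjOn (fun e => (b e, w e)) (T : Set (Fin n)) ∧
      (edgeGraph b w (T : Set (Fin n))).IsTree := by
  have hconn : (edgeGraph b w (T : Set (Fin n))).Connected := by
    rw [SimpleGraph.connected_iff_exists_forall_reachable]
    refine ⟨r, fun v => SimpleGraph.Reachable.symm ?_⟩
    induction hroot v using Relation.ReflTransGen.head_induction_on with
    | refl => exact SimpleGraph.Reachable.refl _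
    | head hac _ ih =>
      refine SimpleGraph.Reachable.trans (SimpleGraph.Adj.reachable ?_) ih
      rw [edgeGraph_adj]
      refine ⟨_, Finset.mem_coe.2 ((hT _).2 ⟨_, hac.1, rfl⟩), ?_⟩
      rw [hpe.ends_eq, hac.2]
  -- Connectivity needs at least one edge fewer than there are vertices, and `T` has at most that
  -- many elements. Equality throughout yields both acyclicity and the absence of parallel edges.
  have h1 := hconn.card_vert_le_card_edgeSet_add_one
  have h2 : T.card ≤ Nat.card (Fin l ⊕ Fin l') - 1 := by
    rw [card_image_nonroot hT, Nat.card_eq_fintype_card, ← Finset.card_univ,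
      ← Finset.card_erase_of_mem (Finset.mem_univ r)]
    exact Finset.card_image_le
  have h3 := card_edgeSet_edgeGraph (b := b) (w := w) T
  have h4 : (T.image fun e => (s(Sum.inl (b e), Sum.inr (w e)) :
      Sym2 (Fin l ⊕ Fin l'))).card ≤ T.card := Finset.card_image_le
  have hpos : 0 < Nat.card (Fin l ⊕ Fin l') :=
    haveI : Nonempty (Fin l ⊕ Fin l') := ⟨r⟩
    Nat.card_pos
  constructor
  · have hinj := Finset.card_image_iff.1 (le_antisymm h4 (by omega))
    intro e he f hf hef
    refine hinj he hf ?_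
    rw [Prod.mk.injEq] at hef
    simp only [hef.1, hef.2]
  · rw [SimpleGraph.isTree_iff_connected_and_card]
    exact ⟨hconn, by omega⟩

/-- A spanning tree comes from a parent function that leads to a given black vertex `β`. -/
theorem exists_rooted_of_isTree {T : Finset (Fin n)}
    (hinj : Set.InjOn (fun e => (b e, w e)) (T : Set (Fin n)))
    (htree : (edgeGraph b w (T : Set (Fin n))).IsTree) (e₀ : Fin n) :
    ∃ pe, IsIncident b w pe ∧ pe (Sum.inl (b e₀)) = e₀ ∧
      Rooted (Sum.inl (b e₀)) (parent b w pe) ∧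
      ∀ e, e ∈ T ↔ ∃ v, v ≠ Sum.inl (b e₀) ∧ pe v = e := by
  classical
  set r : Fin l ⊕ Fin l' := Sum.inl (b e₀) with hr
  set G := edgeGraph b w (T : Set (Fin n)) with hG
  have hstep : ∀ v, ∃ e, v ≠ r → e ∈ T ∧
      ∃ u, s(Sum.inl (b e), Sum.inr (w e)) = s(v, u) ∧ G.dist u r < G.dist v r := by
    intro v
    by_cases hv : v = r
    · exact ⟨e₀, fun h => absurd hv h⟩
    obtain ⟨p, hp⟩ := htree.connected.exists_walk_length_eq_dist v r
    cases p with
    | nil => exact absurd rfl hv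
    | cons hadj p =>
      obtain ⟨e, he, hends⟩ := edgeGraph_adj.1 hadj
      refine ⟨e, fun _ => ⟨he, _, hends, ?_⟩⟩
      rw [SimpleGraph.Walk.length_cons] at hp
      have := SimpleGraph.dist_le p
      omega
  choose q hq using hstep
  let pe : Fin l ⊕ Fin l' → Fin n := Function.update q r e₀
  have hper : pe r = e₀ := Function.update_self ..
  have hpe' : ∀ v, v ≠ r → pe v = q v := fun v hv => Function.update_of_ne hv _ _
  have hinc : IsIncident b w pe := by
    constructor
    · intro i
      by_cases hi : Sum.inl i = r
      · rw [hi, hper]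
        exact Sum.inl_injective (hr.symm.trans hi.symm)
      · obtain ⟨_, u, hu, _⟩ := hq _ hi
        rw [hpe' _ hi]
        rw [Sym2.eq_iff] at hu
        rcases hu with ⟨h, _⟩ | ⟨_, h⟩
        · exact Sum.inl_injective h
        · exact absurd h Sum.inr_ne_inl
    · intro j
      have hj : (Sum.inr j : Fin l ⊕ Fin l') ≠ r := Sum.inr_ne_inl
      obtain ⟨_, u, hu, _⟩ := hq _ hj
      rw [hpe' _ hj]
      rw [Sym2.eq_iff] at hu
      rcases hu with ⟨h, _⟩ | ⟨_, h⟩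
      · exact absurd h Sum.inl_ne_inr
      · exact Sum.inr_injective h
  have hdist : ∀ v, v ≠ r → pe v ∈ T ∧ G.dist (parent b w pe v) r < G.dist v r := by
    intro v hv
    obtain ⟨he, u, hu, hlt⟩ := hq v hv
    rw [← hpe' v hv, hinc.ends_eq] at hu
    rw [hpe' v hv, Sym2.congr_right.1 hu]
    exact ⟨he, hlt⟩
  have hroot : Rooted r (parent b w pe) := by
    have main : ∀ k, ∀ v, G.dist v r ≤ k →
        Relation.ReflTransGen (fun a c => a ≠ r ∧ parent b w pe a = c) v r := by
      intro k
      induction k with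
      | zero =>
        intro v hv
        by_cases hvr : v = r
        · rw [hvr]
        · have := (hdist v hvr).2
          omega
      | succ k ih =>
        intro v hv
        by_cases hvr : v = r
        · rw [hvr]
        · refine Relation.ReflTransGen.head ⟨hvr, rfl⟩ (ih _ ?_)
          have := (hdist v hvr).2
          omega
    exact fun v => main _ v le_rfl
  refine ⟨pe, hinc, hper, hroot, ?_⟩
  have hsub : (Finset.univ.erase r).image pe ⊆ T := by
    intro e he
    obtain ⟨v, hv, rfl⟩ := Finset.mem_image.1 he
    exact (hdist v (Finset.ne_of_mem_erase hv)).1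
  have hpinj : Set.InjOn pe (Finset.univ.erase r : Finset (Fin l ⊕ Fin l')) := by
    intro v hv u hu heq
    by_contra hne
    have h1 := hinc.ends_eq v
    rw [heq, hinc.ends_eq, Sym2.eq_iff] at h1
    rcases h1 with ⟨h, _⟩ | ⟨h, h'⟩
    · exact hne h.symm
    · have h2 := (hdist v (Finset.ne_of_mem_erase hv)).2
      have h3 := (hdist u (Finset.ne_of_mem_erase hu)).2
      rw [← h] at h2
      rw [h'] at h3
      omega
  -- Distinct vertices other than the root have distinct parent edges, and a tree has no further
  -- edges.
  have hcard : T.card ≤ ((Finset.univ.erase r).image pe).card := by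
    rw [Finset.card_image_of_injOn hpinj, Finset.card_erase_of_mem (Finset.mem_univ r),
      Finset.card_univ, ← Nat.card_eq_fintype_card,
      ← (SimpleGraph.isTree_iff_connected_and_card.1 htree).2, hG, card_edgeSet_edgeGraph,
      Finset.card_image_of_injOn, Nat.add_sub_cancel]
    intro e he f hf hef
    refine hinj he hf ?_
    simp only [Sym2.eq_iff, reduceCtorEq, false_and, or_false, Sum.inl.injEq,
      Sum.inr.injEq] at hef
    exact Prod.ext hef.1 hef.2
  intro e
  rw [← Finset.eq_of_subset_of_card_le hsub hcard]
  simp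

/-- A parent function is determined by the spanning tree and its root. -/
theorem Rooted.eq_of_isIncident {pe pe' : Fin l ⊕ Fin l' → Fin n} (hpe : IsIncident b w pe)
    (hpe' : IsIncident b w pe') {r : Fin l ⊕ Fin l'} (hroot : Rooted r (parent b w pe'))
    (hsub : ∀ v, v ≠ r → ∃ u, u ≠ r ∧ pe u = pe' v) {v : Fin l ⊕ Fin l'} (hv : v ≠ r) :
    pe v = pe' v := by
  revert hv
  induction hroot v using Relation.ReflTransGen.head_induction_on with
  | refl => exact fun h => absurd rfl h
  | @head a c hac _ ih =>
    intro ha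
    obtain ⟨u, hu, hua⟩ := hsub a ha
    have h1 := hpe'.ends_eq a
    rw [← hua, hpe.ends_eq, Sym2.eq_iff] at h1
    -- The edge `pe' a` is the `pe`-edge of one of its two ends. If that end were the parent of `a`,
    -- the induction hypothesis would make `a` and its parent point to each other.
    rcases h1 with ⟨rfl, _⟩ | ⟨rfl, _⟩
    · exact hua
    · rw [← hac.2] at ih
      have h2 := hpe'.ends_eq (parent b w pe' a)
      rw [← ih hu, hua, hpe'.ends_eq, Sym2.eq_swap, Sym2.congr_right] at h2
      refine absurd (Relation.ReflTransGen.single ⟨hu, h2.symm⟩) (hroot.not_reflTransGen ha)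

end SepMaps

/-! ### Exit orders -/

namespace SepMaps

variable {n q : ℕ} {time : Fin n → Fin n} {v : Fin n → Fin q} {ρ : Equiv.Perm (Fin n)}

theorem exists_isLastExit (time : Fin n → Fin n) {i : Fin q} (hi : ∃ e, v e = i) :
    ∃ e, v e = i ∧ IsLastExit time v e := by
  obtain ⟨e, he, hmax⟩ := (Finset.univ.filter fun e => v e = i).exists_max_image time
    (by obtain ⟨e, he⟩ := hi; exact ⟨e, by simpa using he⟩)
  simp only [Finset.mem_filter, Finset.mem_univ, true_and] at he hmax
  exact ⟨e, he, fun f hf => hmax f (hf.trans he)⟩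

theorem IsLastExit.eq (ht : Function.Injective time) {e f : Fin n} (he : IsLastExit time v e)
    (hf : IsLastExit time v f) (hv : v e = v f) : e = f :=
  ht (le_antisymm (hf e hv) (he f hv.symm))

namespace IsExitOrder

theorem eq_of_forall_le (h : IsExitOrder time v ρ) (ht : Function.Injective time) {e : Fin n}
    (he : IsLastExit time v e) {r : Fin n} (hr : v r = v e) (hmin : ∀ f, v f = v e →
      time r ≤ time f) : ρ e = r := by
  obtain ⟨hv, h | h⟩ := h e
  · exact absurd (he _ hv) (not_le_of_gt h.1)
  · exact ht (le_antisymm (h r hr).1 (hmin _ hv))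

theorem isLastExit_of_forall_le (h : IsExitOrder time v ρ) {e : Fin n}
    (hmin : ∀ f, v f = v e → time (ρ e) ≤ time f) : IsLastExit time v e := by
  obtain ⟨_, h | h⟩ := h e
  · exact absurd (hmin e rfl) (not_le_of_gt h.1)
  · exact fun f hf => (h f hf).2

/-- When the first edge `r` of the whole tour lies at this vertex, the last exit is its predecessor
in the rotation. This recovers the last exit at the root vertex, where the tree gives none. -/
theorem isLastExit_iff (h : IsExitOrder time v ρ) (ht : Function.Injective time) {e r : Fin n}
    (hr : v r = v e) (hmin : ∀ f, time r ≤ time f) : IsLastExit time v e ↔ ρ e = r :=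
  ⟨fun he => h.eq_of_forall_le ht he hr fun f _ => hmin f,
    fun he => h.isLastExit_of_forall_le fun f _ => he ▸ hmin f⟩

theorem unique {ρ' : Equiv.Perm (Fin n)} (h : IsExitOrder time v ρ) (h' : IsExitOrder time v ρ')
    (ht : Function.Injective time) : ρ = ρ' := by
  ext1 e
  obtain ⟨hv, h1⟩ := h e
  obtain ⟨hv', h1'⟩ := h' e
  apply ht
  rcases h1 with h1 | h1 <;> rcases h1' with h1' | h1'
  · exact le_antisymm (h1.2 _ hv' h1'.1) (h1'.2 _ hv h1.1)
  · exact absurd h1.1 (not_lt_of_ge (h1' _ hv).2)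
  · exact absurd h1'.1 (not_lt_of_ge (h1 _ hv').2)
  · exact le_antisymm (h1 _ hv').1 (h1' _ hv).1

theorem conj (h : IsExitOrder time v ρ) (x : Equiv.Perm (Fin n)) :
    IsExitOrder (time ∘ x) (v ∘ x) (x⁻¹ * ρ * x) := by
  intro e
  obtain ⟨hv, h1⟩ := h (x e)
  have hx : x ((x⁻¹ * ρ * x) e) = ρ (x e) := by simp
  simp only [Function.comp_apply, hx]
  exact ⟨hv, h1.imp (fun h => ⟨h.1, fun f => h.2 (x f)⟩) fun h f => h (x f)⟩

theorem sameCycle_iff (h : IsExitOrder time v ρ) (ht : Function.Injective time) (e f : Fin n) :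
    ρ.SameCycle e f ↔ v e = v f := by
  have hpow : ∀ (k : ℕ) e, v ((ρ ^ k) e) = v e := by
    intro k
    induction k with
    | zero => exact fun e => rfl
    | succ k ih => exact fun e => by rw [pow_succ, Equiv.Perm.mul_apply, ih, (h e).1]
  constructor
  · intro hef
    obtain ⟨k, _, _, rfl⟩ := hef.exists_pow_eq
    exact (hpow k e).symm
  -- Going backwards in the rotation decreases the time until the first exit `f` is reached.
  · have main : ∀ k, ∀ e, (time e : ℕ) = k → ∀ f, v f = v e → (∀ f', v f' = v e →
        time f ≤ time f') → ρ.SameCycle f e := by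
      intro k
      induction k using Nat.strong_induction_on with
      | _ k ih =>
        intro e hk f hf hmin
        by_cases hef : f = e
        · rw [hef]
        obtain ⟨e', rfl⟩ := ρ.surjective e
        obtain ⟨hv, h1 | h1⟩ := h e'
        · rw [Equiv.Perm.sameCycle_apply_right]
          exact ih _ (hk ▸ h1.1) e' rfl f (hf.trans hv) fun f' hf' => hmin f' (hf'.trans hv.symm)
        · exact absurd (ht (le_antisymm (hmin _ rfl) (h1 f (hf.trans hv)).1)) hef
    intro hef
    obtain ⟨g, hg, hmin⟩ := (Finset.univ.filter fun f' => v f' = v e).exists_min_image time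
      ⟨e, by simp⟩
    simp only [Finset.mem_filter, Finset.mem_univ, true_and] at hg hmin
    exact (main _ e rfl g hg hmin).symm.trans
      (main _ f rfl g (hg.trans hef) fun f' hf' => hmin f' (hf'.trans hef.symm))

/-- An isomorphism that respects the rotations and the last exits respects the times. -/
theorem lt_iff_lt {time' : Fin n → Fin n} {v' : Fin n → Fin q} {ρ' φ : Equiv.Perm (Fin n)}
    (h : IsExitOrder time v ρ) (h' : IsExitOrder time' v' ρ') (ht : Function.Injective time)
    (hρ : ∀ e, ρ' (φ e) = φ (ρ e))
    (hlast : ∀ e, IsLastExit time' v' (φ e) → IsLastExit time v e) {e f : Fin n}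
    (hef : v e = v f) : time e < time f ↔ time' (φ e) < time' (φ f) := by
  have main : ∀ k, ∀ f, (time f : ℕ) = k → ∀ e, v e = v f → time e < time f →
      time' (φ e) < time' (φ f) := by
    intro k
    induction k using Nat.strong_induction_on with
    | _ k ih =>
      intro f hk e hvef hlt
      obtain ⟨f', rfl⟩ := ρ.surjective f
      obtain ⟨hvf, h1 | h1⟩ := h f'
      -- A rotation step increases the time except at a last exit, and `φ f'` is not one because
      -- `f'` is not.
      · have hlt' : time' (φ f') < time' (φ (ρ f')) := by
          rw [← hρ]
          obtain ⟨_, h2 | h2⟩ := h' (φ f')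
          · exact h2.1
          · exact absurd (hlast f' (fun g hg => (h2 g hg).2) _ hvf) (not_le_of_gt h1.1)
        have hle : time e ≤ time f' := by
          by_contra! hcon
          exact absurd (h1.2 e (hvef.trans hvf) hcon) (not_le_of_gt hlt)
        rcases hle.lt_or_eq with hlt2 | heq
        · exact (ih _ (hk ▸ h1.1) f' rfl e (hvef.trans hvf) hlt2).trans hlt'
        · rwa [ht heq]
      · exact absurd (h1 e (hvef.trans hvf)).1 (not_le_of_gt hlt)
  refine ⟨main _ f rfl e hef, fun hlt => ?_⟩
  rcases lt_trichotomy (time e) (time f) with h1 | h1 | h1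
  · exact h1
  · rw [ht h1] at hlt
    exact absurd hlt (lt_irrefl _)
  · exact absurd (main _ e rfl f hef.symm h1) (lt_asymm hlt)

end IsExitOrder

theorem exists_isExitOrder (ht : Function.Injective time) (v : Fin n → Fin q) :
    ∃ ρ, IsExitOrder time v ρ := by
  have hex : ∀ e, ∃ f, v f = v e ∧
      ((time e < time f ∧ ∀ f', v f' = v e → time e < time f' → time f ≤ time f') ∨
        ∀ f', v f' = v e → time f ≤ time f' ∧ time f' ≤ time e) := by
    intro e
    by_cases he : IsLastExit time v e
    · obtain ⟨f, hf, hmin⟩ := (Finset.univ.filter fun f => v f = v e).exists_min_image time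
        ⟨e, by simp⟩
      simp only [Finset.mem_filter, Finset.mem_univ, true_and] at hf hmin
      exact ⟨f, hf, Or.inr fun f' hf' => ⟨hmin f' hf', he f' hf'⟩⟩
    · rw [IsLastExit] at he
      push Not at he
      obtain ⟨f, hf, hmin⟩ :=
        (Finset.univ.filter fun f => v f = v e ∧ time e < time f).exists_min_image time
        (by obtain ⟨f, hf⟩ := he; exact ⟨f, by simpa using hf⟩)
      simp only [Finset.mem_filter, Finset.mem_univ, true_and] at hf hmin
      exact ⟨f, hf.1, Or.inl ⟨hf.2, fun f' hf' hlt => hmin f' ⟨hf', hlt⟩⟩⟩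
  choose next hv hnext using hex
  have hinj : Function.Injective next := by
    intro e e' heq
    have hvv : v e = v e' := by rw [← hv, heq, hv]
    rcases hnext e with h1 | h1 <;> rcases hnext e' with h2 | h2
    · rcases lt_trichotomy (time e) (time e') with hlt | hlt | hlt
      · exact absurd (h1.2 e' hvv.symm hlt) (not_le_of_gt (heq ▸ h2.1))
      · exact ht hlt
      · exact absurd (h2.2 e hvv hlt) (not_le_of_gt (heq ▸ h1.1))
    · exact absurd (h2 e hvv).1 (not_le_of_gt (heq ▸ h1.1))
    · exact absurd (h1 e' hvv.symm).1 (not_le_of_gt (heq ▸ h2.1))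
    · exact ht (le_antisymm (h2 e hvv).2 (h1 e' hvv.symm).2)
  exact ⟨Equiv.ofBijective next (Finite.injective_iff_bijective.1 hinj),
    fun e => ⟨hv e, hnext e⟩⟩

/-- A rotation becomes a linear order around each vertex when the last edge is chosen. -/
theorem exists_rank (hρ : ∀ e f, ρ.SameCycle e f ↔ v e = v f) (last : Fin q → Fin n)
    (hlast : ∀ i, v (last i) = i) :
    ∃ ord : Fin n → ℕ, (∀ e f, v e = v f → ord e = ord f → e = f) ∧
      (∀ e, ord e ≤ ord (last (v e))) ∧ (∀ e, e ≠ last (v e) → ord (ρ e) = ord e + 1) ∧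
      ∀ i, ord (ρ (last i)) = 0 := by
  have hv : ∀ e, v (ρ e) = v e := fun e =>
    ((hρ _ _).1 (Equiv.Perm.SameCycle.rfl.apply_right)).symm
  have hex : ∀ e, ∃ k : ℕ, (ρ ^ k) (ρ (last (v e))) = e := by
    intro e
    obtain ⟨k, _, _, hk⟩ := ((hρ (ρ (last (v e))) e).2 ((hv _).trans (hlast _))).exists_pow_eq
    exact ⟨k, hk⟩
  -- The rank counts the rotation steps from the successor of the chosen last edge.
  obtain ⟨ord, hspec, hmin⟩ : ∃ ord : Fin n → ℕ, (∀ e, (ρ ^ ord e) (ρ (last (v e))) = e) ∧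
      ∀ e k, (ρ ^ k) (ρ (last (v e))) = e → ord e ≤ k :=
    ⟨fun e => Nat.find (hex e), fun e => Nat.find_spec (hex e), fun e k => Nat.find_min' (hex e)⟩
  refine ⟨ord, fun e f hvef heq => ?_, fun e => ?_, fun e he => ?_, fun i => ?_⟩
  · rw [← hspec e, ← hspec f, heq, hvef]
  · by_contra! hcon
    have h1 := hspec (last (v e))
    rw [hlast] at h1
    obtain ⟨j, hj⟩ := Nat.exists_eq_add_of_lt hcon
    have h2 := hspec e
    have := hmin e j (by
      rw [hj, show ord (last (v e)) + j + 1 = j + (ord (last (v e)) + 1) by ring, pow_add,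
        Equiv.Perm.mul_apply, pow_succ', Equiv.Perm.mul_apply, h1] at h2
      exact h2)
    omega
  · have hle := hmin (ρ e) (ord e + 1) (by
      rw [pow_succ', Equiv.Perm.mul_apply, hv, hspec])
    have h1 := hspec (ρ e)
    rw [hv] at h1
    rcases hk : ord (ρ e) with _ | j
    · rw [hk] at h1
      exact absurd (ρ.injective h1.symm) he
    · rw [hk, pow_succ', Equiv.Perm.mul_apply] at h1
      have := hmin e j (ρ.injective h1)
      omega
  · refine Nat.le_zero.1 (hmin _ 0 ?_)
    rw [hv, hlast]
    rfl

/-- Closing up the linear orders cut from a rotation gives the rotation back, so times that increase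
with the rank have `ρ` as exit order. -/
theorem isExitOrder_of_rank (hv : ∀ e, v (ρ e) = v e) {last : Fin q → Fin n} {ord : Fin n → ℕ}
    (hinj : ∀ e f, v e = v f → ord e = ord f → e = f) (hle : ∀ e, ord e ≤ ord (last (v e)))
    (hsucc : ∀ e, e ≠ last (v e) → ord (ρ e) = ord e + 1) (hzero : ∀ i, ord (ρ (last i)) = 0)
    (htime : ∀ e f, v e = v f → ord e < ord f → time e < time f) : IsExitOrder time v ρ := by
  have hmono : ∀ e f, v e = v f → ord e ≤ ord f → time e ≤ time f := by
    intro e f hef h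
    rcases h.lt_or_eq with h | h
    · exact (htime e f hef h).le
    · rw [hinj e f hef h]
  intro e
  refine ⟨hv e, ?_⟩
  by_cases he : e = last (v e)
  · refine Or.inr fun f hf => ⟨hmono _ _ ((hv e).trans hf.symm) ?_, hmono _ _ hf ?_⟩
    · rw [he, hzero]
      exact Nat.zero_le _
    · have := hle f
      rwa [hf, ← he] at this
  · have hs := hsucc e he
    refine Or.inl ⟨htime _ _ (hv e).symm (by omega), fun f hf hlt => ?_⟩
    refine hmono _ _ ((hv e).trans hf.symm) ?_
    rw [hs]
    by_contra! hcon
    exact absurd (hmono f e hf (by omega)) (not_le_of_gt hlt)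

end SepMaps

/-! ### Bernardi's bijection -/

namespace SepMaps

variable {n l l' : ℕ}

theorem IsCycleColoring.apply_eq {q : ℕ} {π : Equiv.Perm (Fin n)} {c : Fin n → Fin q}
    (h : IsCycleColoring π c) (e : Fin n) : c (π e) = c e :=
  h _ _ Equiv.Perm.SameCycle.rfl.apply_left

theorem isCycleColoring_of_apply_eq {q : ℕ} {π : Equiv.Perm (Fin n)} {c : Fin n → Fin q}
    (h : ∀ e, c (π e) = c e) : IsCycleColoring π c := by
  have hpow : ∀ (k : ℕ) e, c ((π ^ k) e) = c e := by
    intro k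
    induction k with
    | zero => exact fun e => rfl
    | succ k ih => exact fun e => by rw [pow_succ, Equiv.Perm.mul_apply, ih, h]
  intro i j hij
  obtain ⟨k, _, _, rfl⟩ := hij.exists_pow_eq
  exact (hpow k i).symm

theorem colorCount_comp {q : ℕ} (c : Fin n → Fin q) (x : Equiv.Perm (Fin n)) (i : Fin q) :
    colorCount (c ∘ x) i = colorCount c i :=
  Finset.card_equiv x (by simp)

theorem surjective_of_colorCount {q : ℕ} {c : Fin n → Fin q} {γ : Fin q → ℕ}
    (hc : ∀ i, colorCount c i = γ i) (hγ : ∀ i, 0 < γ i) : Function.Surjective c := by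
  intro i
  have := hγ i
  rw [← hc, colorCount, Finset.card_pos] at this
  obtain ⟨e, he⟩ := this
  exact ⟨e, by simpa using he⟩

section LastExits

variable {b : Fin n → Fin l} {w : Fin n → Fin l'} {tb tw : Fin n → Fin n}
  {pe : Fin l ⊕ Fin l' → Fin n}

theorem exists_isLast (tb tw : Fin n → Fin n) (hb : Function.Surjective b)
    (hw : Function.Surjective w) :
    ∃ pe, IsLast b w (fun e => (tb e : ℕ)) (fun e => (tw e : ℕ)) pe := by
  choose pb hpb hpb' using fun i => exists_isLastExit tb (hb i)
  choose pw hpw hpw' using fun j => exists_isLastExit tw (hw j)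
  exact ⟨Sum.elim pb pw, ⟨hpb, hpw⟩, fun e => hpb' _ e (hpb _).symm,
    fun e => hpw' _ e (hpw _).symm⟩

theorem IsLast.black_iff (h : IsLast b w (fun e => (tb e : ℕ)) (fun e => (tw e : ℕ)) pe)
    (htb : Function.Injective tb) (e : Fin n) :
    IsLastExit tb b e ↔ pe (Sum.inl (b e)) = e := by
  have hpe : IsLastExit tb b (pe (Sum.inl (b e))) := fun f hf => by
    have := h.black_le f
    rwa [hf, h.black] at this
  exact ⟨fun he => hpe.eq htb he (h.black _), fun he => he ▸ hpe⟩

theorem IsLast.white_iff (h : IsLast b w (fun e => (tb e : ℕ)) (fun e => (tw e : ℕ)) pe)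
    (htw : Function.Injective tw) (e : Fin n) :
    IsLastExit tw w e ↔ pe (Sum.inr (w e)) = e := by
  have hpe : IsLastExit tw w (pe (Sum.inr (w e))) := fun f hf => by
    have := h.white_le f
    rwa [hf, h.white] at this
  exact ⟨fun he => hpe.eq htw he (h.white _), fun he => he ▸ hpe⟩

theorem IsLast.exists_iff (h : IsLast b w (fun e => (tb e : ℕ)) (fun e => (tw e : ℕ)) pe)
    (htb : Function.Injective tb) (htw : Function.Injective tw) (β : Fin l) (e : Fin n) :
    (∃ v, v ≠ Sum.inl β ∧ pe v = e) ↔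
      (b e ≠ β ∧ IsLastExit tb b e) ∨ IsLastExit tw w e := by
  rw [h.black_iff htb, h.white_iff htw]
  constructor
  · rintro ⟨i | j, hv, rfl⟩
    · rw [h.black]
      exact Or.inl ⟨fun hi => hv (congrArg _ hi), rfl⟩
    · rw [h.white]
      exact Or.inr rfl
  · rintro (⟨hb, he⟩ | he)
    · exact ⟨_, fun hi => hb (Sum.inl_injective hi), he⟩
    · exact ⟨_, Sum.inr_ne_inl, he⟩

end LastExits

variable {γ : Fin l → ℕ} {δ : Fin l' → ℕ}

/-- A colored factorization is a tour in which the `t`-th edge used to leave a black vertex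
is `t`. -/
theorem isTour_of_mem {x : Equiv.Perm (Fin n) × (Fin n → Fin l) × (Fin n → Fin l')}
    (hx : x ∈ coloredFactorizations n γ δ) :
    IsTour x.2.1 x.2.2 (fun e => ((id e : Fin n) : ℕ)) (fun e => ((prodCycle x.1).symm e : ℕ)) 1
      (prodCycle x.1) where
  white_eq t := hx.2.1.apply_eq t
  black_eq t := hx.1.1.apply_eq _
  black_mono s t _ h := h
  white_mono s t _ h := by simpa using h

theorem exists_isBernardiMap (hn : 0 < n) (hγ : ∀ i, 0 < γ i) (hδ : ∀ i, 0 < δ i)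
    {x : Equiv.Perm (Fin n) × (Fin n → Fin l) × (Fin n → Fin l')}
    (hx : x ∈ coloredFactorizations n γ δ) :
    ∃ M : TreeRootedMap n l l', M.HasDegrees γ δ ∧ IsBernardiMap x M := by
  classical
  have hσ := (prodCycle x.1).symm.injective
  obtain ⟨pe, hpe⟩ := exists_isLast id (prodCycle x.1).symm
    (surjective_of_colorCount hx.1.2 hγ) (surjective_of_colorCount hx.2.2 hδ)
  have hroot := (isTour_of_mem hx).rooted hpe (t₀ := ⟨0, hn⟩) rfl
  obtain ⟨ρb, hρb⟩ := exists_isExitOrder Function.injective_id x.2.1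
  obtain ⟨ρw, hρw⟩ := exists_isExitOrder hσ x.2.2
  let T : Finset (Fin n) := (Finset.univ.erase (Sum.inl (x.2.1 ⟨0, hn⟩))).image pe
  have hT : ∀ e, e ∈ T ↔ ∃ v, v ≠ Sum.inl (x.2.1 ⟨0, hn⟩) ∧ pe v = e := by
    intro e
    simp [T]
  have htree := hroot.isTree hpe.toIsIncident hT
  exact ⟨{ blackEnd := x.2.1
           whiteEnd := x.2.2
           blackRot := ρb
           whiteRot := ρw
           blackRot_sameCycle := hρb.sameCycle_iff Function.injective_id
           whiteRot_sameCycle := hρw.sameCycle_iff hσ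
           connected := htree.2.connected.mono (edgeGraph_mono (Set.subset_univ _))
           root := ⟨0, hn⟩
           tree := T
           tree_injOn := htree.1
           tree_isTree := htree.2 },
    ⟨hx.1.2, hx.2.2⟩, rfl, rfl, hρb, hρw, rfl,
    fun e => (hT e).trans (hpe.exists_iff Function.injective_id hσ _ e)⟩

theorem IsBernardiMap.unique {x : Equiv.Perm (Fin n) × (Fin n → Fin l) × (Fin n → Fin l')}
    {M M' : TreeRootedMap n l l'} (h : IsBernardiMap x M) (h' : IsBernardiMap x M') : M = M' := by
  have hb := h.blackEnd.trans h'.blackEnd.symm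
  have hw := h.whiteEnd.trans h'.whiteEnd.symm
  have hρb := h.blackRot.unique h'.blackRot Function.injective_id
  have hρw := h.whiteRot.unique h'.whiteRot (prodCycle x.1).symm.injective
  have hr : M.root = M'.root := Fin.ext (h.root.trans h'.root.symm)
  have ht : M.tree = M'.tree := Finset.ext fun e => by rw [h.tree, h'.tree, hr]
  obtain ⟨⟨_, _, _, _, _, _, _, _⟩, _, _, _⟩ := M
  obtain ⟨⟨_, _, _, _, _, _, _, _⟩, _, _, _⟩ := M'
  simp only at hb hw hρb hρw hr ht
  subst hb hw hρb hρw hr ht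
  rfl

/-- A colored factorization can be recovered from the isomorphism class of its map. -/
theorem IsBernardiMap.eq_of_isIso (hγ : ∀ i, 0 < γ i) (hδ : ∀ i, 0 < δ i)
    {x x' : Equiv.Perm (Fin n) × (Fin n → Fin l) × (Fin n → Fin l')}
    (hx : x ∈ coloredFactorizations n γ δ) (hx' : x' ∈ coloredFactorizations n γ δ)
    {M M' : TreeRootedMap n l l'} (hM : IsBernardiMap x M) (hM' : IsBernardiMap x' M')
    {φ : Equiv.Perm (Fin n)} (hφ : TreeRootedMap.IsIso φ M M') : φ = 1 ∧ x = x' := by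
  have hσ := (prodCycle x.1).symm.injective
  have hσ' := (prodCycle x'.1).symm.injective
  obtain ⟨pe, hpe⟩ := exists_isLast id (prodCycle x.1).symm
    (surjective_of_colorCount hx.1.2 hγ) (surjective_of_colorCount hx.2.2 hδ)
  obtain ⟨pe', hpe'⟩ := exists_isLast id (prodCycle x'.1).symm
    (surjective_of_colorCount hx'.1.2 hγ) (surjective_of_colorCount hx'.2.2 hδ)
  have hb : ∀ e, x'.2.1 (φ e) = x.2.1 e := by rw [← hM.blackEnd, ← hM'.blackEnd]; exact hφ.blackEnd
  have hw : ∀ e, x'.2.2 (φ e) = x.2.2 e := by rw [← hM.whiteEnd, ← hM'.whiteEnd]; exact hφ.whiteEnd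
  have hb' : ∀ e, x.2.1 (φ.symm e) = x'.2.1 e := fun e => by rw [← hb, φ.apply_symm_apply]
  have hw' : ∀ e, x.2.2 (φ.symm e) = x'.2.2 e := fun e => by rw [← hw, φ.apply_symm_apply]
  have hrr : x'.2.1 M'.root = x.2.1 M.root := by rw [hφ.root, hb]
  have hroot' := (isTour_of_mem hx').rooted hpe' hM'.root
  rw [Equiv.Perm.one_apply, hrr] at hroot'
  -- The last exits of `x'`, pulled back along `φ`, are a parent function for the tree of `M` with
  -- the same root; hence they agree with those of `x` away from the root.
  let qe : Fin l ⊕ Fin l' → Fin n := fun v => φ.symm (pe' v)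
  have hqe : IsIncident x.2.1 x.2.2 qe :=
    ⟨fun i => (hb' _).trans (hpe'.black i), fun j => (hw' _).trans (hpe'.white j)⟩
  have hpar : parent x.2.1 x.2.2 qe = parent x'.2.1 x'.2.2 pe' := by
    funext v
    rcases v with i | j
    · exact congrArg Sum.inr (hw' _)
    · exact congrArg Sum.inl (hb' _)
  rw [← hpar] at hroot'
  have heq : ∀ v, v ≠ Sum.inl (x.2.1 M.root) → pe v = qe v := by
    intro v hv
    refine hroot'.eq_of_isIncident hpe.toIsIncident hqe (fun u hu => ?_) hv
    rw [hpe.exists_iff Function.injective_id hσ, ← hM.tree, ← hφ.tree, hM'.tree,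
      ← hpe'.exists_iff Function.injective_id hσ', hrr]
    exact ⟨u, hu, (φ.apply_symm_apply _).symm⟩
  have hblast : ∀ e, IsLastExit id x'.2.1 (φ e) → IsLastExit id x.2.1 e := by
    intro e he
    -- At the root vertex the last exit is read off from the rotation and the root; elsewhere it is
    -- read off from the tree.
    by_cases hbe : x.2.1 e = x.2.1 M.root
    · have hmin : ∀ (r : Fin n), (r : ℕ) = 0 → ∀ f, (id r : Fin n) ≤ id f := fun r hr f => by
        rw [id, id, Fin.le_def, hr]
        exact Nat.zero_le _
      rw [hM'.blackRot.isLastExit_iff Function.injective_id (r := M'.root) (by rw [hb, hbe, hrr])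
        (hmin _ hM'.root), hφ.root, hφ.blackRot, φ.injective.eq_iff] at he
      rwa [hM.blackRot.isLastExit_iff Function.injective_id hbe.symm (hmin _ hM.root)]
    · rw [hpe'.black_iff Function.injective_id, hb] at he
      rw [hpe.black_iff Function.injective_id, heq _ fun h => hbe (Sum.inl_injective h)]
      exact (Equiv.symm_apply_eq φ).2 he
  have hwlast : ∀ e, IsLastExit (prodCycle x'.1).symm x'.2.2 (φ e) →
      IsLastExit (prodCycle x.1).symm x.2.2 e := by
    intro e he
    rw [hpe'.white_iff hσ', hw] at he
    rw [hpe.white_iff hσ, heq _ Sum.inr_ne_inl]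
    exact (Equiv.symm_apply_eq φ).2 he
  -- Since `φ` respects the orders, the tour of `x'` pulled back along `φ` is a tour for the orders
  -- of `x` with the same start. Uniqueness then forces `φ⁻¹ = 1`.
  have htour : IsTour x.2.1 x.2.2 (fun e => ((id e : Fin n) : ℕ))
      (fun e => ((prodCycle x.1).symm e : ℕ)) φ⁻¹ (φ⁻¹ * prodCycle x'.1) := by
    refine ⟨fun t => ?_, fun t => ?_, fun s t hst hlt => ?_, fun s t hst hlt => ?_⟩
    · exact (hw' _).trans ((hx'.2.1.apply_eq t).trans (hw' _).symm)
    · exact (hb' _).trans (((isTour_of_mem hx').black_eq t).trans (hb' _).symm)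
    · refine (hM.blackRot.lt_iff_lt hM'.blackRot Function.injective_id hφ.blackRot hblast hst).2 ?_
      simpa using hlt
    · refine (hM.whiteRot.lt_iff_lt hM'.whiteRot hσ hφ.whiteRot hwlast hst).2 ?_
      simpa using hlt
  obtain ⟨h1, h2⟩ := (isTour_of_mem hx).unique htour fun t ht => by
    have htr : t = M.root := Fin.ext (ht.trans hM.root.symm)
    have : φ⁻¹ t = t := by
      rw [Equiv.Perm.inv_eq_iff_eq, htr, ← hφ.root]
      exact Fin.ext (hM.root.trans hM'.root.symm)
    rw [this, Equiv.Perm.one_apply]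
  have hφ1 : φ = 1 := inv_eq_one.1 h1.symm
  subst hφ1
  refine ⟨rfl, Prod.ext ?_ (Prod.ext (funext hb') (funext hw'))⟩
  rw [inv_one, one_mul] at h2
  exact mul_right_cancel h2

/-- Every tree-rooted map comes from a colored factorization. -/
theorem exists_isIso_isBernardiMap (hγ : ∀ i, 0 < γ i) (hδ : ∀ i, 0 < δ i)
    (M : TreeRootedMap n l l') (hM : M.HasDegrees γ δ) :
    ∃ x ∈ coloredFactorizations n γ δ, ∃ N φ, IsBernardiMap x N ∧
      TreeRootedMap.IsIso φ M N := by
  have hn : 0 < n := M.root.pos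
  set b := M.blackEnd with hb
  set w := M.whiteEnd with hw
  have hρb : ∀ e, b (M.blackRot e) = b e := fun e =>
    ((M.blackRot_sameCycle _ _).1 Equiv.Perm.SameCycle.rfl.apply_right).symm
  have hρw : ∀ e, w (M.whiteRot e) = w e := fun e =>
    ((M.whiteRot_sameCycle _ _).1 Equiv.Perm.SameCycle.rfl.apply_right).symm
  -- Taking the predecessor of the root as last exit of the root vertex makes the root edge the
  -- first one there, so that the tour begins with it.
  set e₀ := M.blackRot.symm M.root with he₀
  have hbe₀ : b e₀ = b M.root := by rw [← hρb, he₀, Equiv.apply_symm_apply]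
  obtain ⟨pe, hinc, hpe₀, hroot, hT⟩ := exists_rooted_of_isTree M.tree_injOn M.tree_isTree e₀
  obtain ⟨ob, hob1, hob2, hob3, hob4⟩ := exists_rank M.blackRot_sameCycle _ hinc.black
  obtain ⟨ow, how1, how2, how3, how4⟩ := exists_rank M.whiteRot_sameCycle _ hinc.white
  obtain ⟨X, Y, hXY, hX0⟩ := exists_isTour hob1 how1 ⟨hinc, hob2, how2⟩ hroot
  have hob : ∀ e f, b e = b f → (ob e < ob f ↔ X.symm e < X.symm f) := by
    have h1 : ∀ e f, b e = b f → X.symm e < X.symm f → ob e < ob f := fun e f hef hlt => by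
      simpa using hXY.black_mono (X.symm e) (X.symm f) (by simpa using hef) hlt
    refine fun e f hef => ⟨fun hlt => ?_, h1 e f hef⟩
    rcases lt_trichotomy (X.symm e) (X.symm f) with h | h | h
    · exact h
    · rw [X.symm.injective h] at hlt
      exact absurd hlt (lt_irrefl _)
    · exact absurd (h1 f e hef.symm h) (lt_asymm hlt)
  have how : ∀ e f, w e = w f → (ow e < ow f ↔ Y.symm e < Y.symm f) := by
    have h1 : ∀ e f, w e = w f → Y.symm e < Y.symm f → ow e < ow f := fun e f hef hlt => by
      simpa using hXY.white_mono (Y.symm e) (Y.symm f) (by simpa using hef) hlt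
    refine fun e f hef => ⟨fun hlt => ?_, h1 e f hef⟩
    rcases lt_trichotomy (Y.symm e) (Y.symm f) with h | h | h
    · exact h
    · rw [Y.symm.injective h] at hlt
      exact absurd hlt (lt_irrefl _)
    · exact absurd (h1 f e hef.symm h) (lt_asymm hlt)
  have hlast : IsLast b w (fun e => (X.symm e : ℕ)) (fun e => (Y.symm e : ℕ)) pe := by
    refine ⟨hinc, fun e => ?_, fun e => ?_⟩
    · by_contra! hcon
      exact absurd ((hob _ _ (hinc.black _)).2 hcon) (not_lt_of_ge (hob2 e))
    · by_contra! hcon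
      exact absurd ((how _ _ (hinc.white _)).2 hcon) (not_lt_of_ge (how2 e))
  have hX0' : X ⟨0, hn⟩ = M.root := by
    obtain ⟨t, ht⟩ := X.surjective M.root
    by_contra hne
    have hlt : (⟨0, hn⟩ : Fin n) < t := by
      refine Fin.lt_def.2 (Nat.pos_of_ne_zero fun h0 => hne ?_)
      rw [← ht]
      exact congrArg X (Fin.ext h0.symm)
    have h1 := hXY.black_mono _ _ (by rw [hX0 _ rfl, ht]; exact hbe₀) hlt
    have h2 := hob4 (b e₀)
    rw [hpe₀, he₀, Equiv.apply_symm_apply, ← ht] at h2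
    omega
  -- Rename each edge by the time at which it leaves its black end. The edge leaving a white vertex
  -- at time `t` becomes `X⁻¹ (Y t)`, which must be `σ t`; the factor `(finRotate n)⁻¹` passes from
  -- `σ` to `π`.
  let x : Equiv.Perm (Fin n) × (Fin n → Fin l) × (Fin n → Fin l') :=
    ((X⁻¹ * Y) * (finRotate n)⁻¹, b ∘ X, w ∘ X)
  have hprod : prodCycle x.1 = X⁻¹ * Y := inv_mul_cancel_right _ _
  have hsymm : ((prodCycle x.1).symm : Fin n → Fin n) = Y.symm ∘ X := by rw [hprod]; rfl
  have hx : x ∈ coloredFactorizations n γ δ := by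
    refine ⟨⟨isCycleColoring_of_apply_eq fun e => ?_, fun i => ?_⟩,
      isCycleColoring_of_apply_eq fun e => ?_, fun i => ?_⟩
    · obtain ⟨e, rfl⟩ := (finRotate n).surjective e
      change b (X (X.symm (Y ((finRotate n).symm (finRotate n e))))) = b (X (finRotate n e))
      rw [Equiv.apply_symm_apply, Equiv.symm_apply_apply]
      exact hXY.black_eq e
    · exact (colorCount_comp b X i).trans (hM.1 i)
    · rw [hprod]
      simpa [x] using hXY.white_eq e
    · exact (colorCount_comp w X i).trans (hM.2 i)
  obtain ⟨N, -, hN⟩ := exists_isBernardiMap hn hγ hδ hx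
  refine ⟨x, hx, N, X.symm, hN, ?_⟩
  have hρbX : N.blackRot = X⁻¹ * M.blackRot * X := by
    refine hN.blackRot.unique ?_ Function.injective_id
    have := (isExitOrder_of_rank (time := X.symm) hρb hob1 hob2 hob3 hob4
      fun e f hef h => (hob e f hef).1 h).conj X
    rwa [Equiv.symm_comp_self] at this
  have hρwX : N.whiteRot = X⁻¹ * M.whiteRot * X := by
    refine hN.whiteRot.unique ?_ (prodCycle x.1).symm.injective
    rw [hsymm]
    exact (isExitOrder_of_rank (time := Y.symm) hρw how1 how2 how3 how4
      fun e f hef h => (how e f hef).1 h).conj X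
  have hroot0 : N.root = X.symm M.root := by
    rw [← hX0', Equiv.symm_apply_apply]
    exact Fin.ext hN.root
  refine ⟨fun e => ?_, fun e => ?_, fun e => ?_, fun e => ?_, hroot0, fun e => ?_⟩
  · rw [hN.blackEnd]
    exact congrArg b (X.apply_symm_apply e)
  · rw [hN.whiteEnd]
    exact congrArg w (X.apply_symm_apply e)
  · simp [hρbX]
  · simp [hρwX]
  · have hcomp : ∀ {q : ℕ} (time : Fin n → Fin n) (v : Fin n → Fin q),
        IsLastExit (time ∘ X) (v ∘ X) (X.symm e) ↔ IsLastExit time v e := by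
      intro q time v
      simp only [IsLastExit, Function.comp_apply, Equiv.apply_symm_apply]
      exact ⟨fun h f hf => by simpa using h (X.symm f) (by simpa using hf), fun h f => h (X f)⟩
    have hid : (id : Fin n → Fin n) = X.symm ∘ X := X.symm_comp_self.symm
    rw [hN.tree, hsymm, hid, hcomp, hcomp, hroot0, hT,
      hlast.exists_iff X.symm.injective Y.symm.injective,
      show M.blackEnd e₀ = b M.root from hbe₀]
    simp [x]

end SepMaps

/-! ### The bijections on isomorphism classes, without and with marks. -/

namespace SepMaps

variable {n l : ℕ} {γ : Fin l → ℕ}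

theorem IsBernardiMap.isMarking {k r : ℕ} {δ : Fin (k + r) → ℕ} {α : Fin k → ℕ}
    (y : separatedFactorizationsWith n γ δ α) {M : TreeRootedMap n l (k + r)}
    (hM : IsBernardiMap (forgetSets y).1 M) {X : Finset (Fin n)}
    (hX : ∀ e, e ∈ X ↔ ∃ i, e ∈ y.1.2.1 i) : M.IsMarking α X := by
  have hcol : ∀ i, ∀ e ∈ y.1.2.1 i, M.whiteEnd e = Fin.castAdd r i := by
    rw [hM.whiteEnd]
    exact y.2.1.2.2.2.2
  constructor
  · intro i
    rw [← y.2.1.1.2 i]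
    congr 1
    ext e
    rw [Finset.mem_filter, hX]
    constructor
    · rintro ⟨⟨j, hj⟩, he⟩
      rw [hcol j e hj, Fin.castAdd_inj] at he
      rwa [← he]
    · exact fun he => ⟨⟨i, he⟩, hcol i e he⟩
  · intro e he
    obtain ⟨i, hi⟩ := (hX e).1 he
    exact ⟨i, hcol i e hi⟩

/-- Bernardi's bijection. -/
theorem exists_bernardi_equiv {l' : ℕ} {δ : Fin l' → ℕ} (hn : 0 < n) (hγ : ∀ i, 0 < γ i)
    (hδ : ∀ i, 0 < δ i) :
    ∃ Φ : coloredFactorizations n γ δ ≃ TreeRootedMaps n γ δ,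
      ∀ x, ∃ (M : TreeRootedMap n l l') (hM : M.HasDegrees γ δ),
        IsBernardiMap x.1 M ∧ Φ x = Quotient.mk (treeRootedSetoid n γ δ) ⟨M, hM⟩ := by
  choose M hM hMx using fun x : coloredFactorizations n γ δ =>
    exists_isBernardiMap hn hγ hδ x.2
  refine ⟨Equiv.ofBijective
    (fun x => Quotient.mk (treeRootedSetoid n γ δ) ⟨M x, hM x⟩) ⟨fun x x' h => ?_, fun z => ?_⟩,
    fun x => ⟨M x, hM x, hMx x, rfl⟩⟩
  · obtain ⟨φ, hφ⟩ := Quotient.exact h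
    exact Subtype.ext ((hMx x).eq_of_isIso hγ hδ x.2 x'.2 (hMx x') hφ).2
  · induction z using Quotient.inductionOn with
    | _ P =>
      obtain ⟨x, hx, N, φ, hN, hφ⟩ := exists_isIso_isBernardiMap hγ hδ P.1 P.2
      refine ⟨⟨x, hx⟩, Quotient.sound ?_⟩
      have hNM : N = M ⟨x, hx⟩ := hN.unique (hMx ⟨x, hx⟩)
      exact ⟨φ.symm, (hNM ▸ hφ).symm⟩

/-- The extension of Bernardi's bijection to marked maps. -/
theorem exists_marked_bernardi_equiv {k r : ℕ} {δ : Fin (k + r) → ℕ} (hn : 0 < n)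
    (hγ : ∀ i, 0 < γ i) (hδ : ∀ i, 0 < δ i) (α : Fin k → ℕ) :
    ∃ Ψ : separatedFactorizationsWith n γ δ α ≃ MarkedTreeRootedMaps n γ δ α,
      ∀ y, ∃ (M : TreeRootedMap n l (k + r)) (X : Finset (Fin n))
        (hM : M.HasDegrees γ δ ∧ M.IsMarking α X), IsBernardiMap (forgetSets y).1 M ∧
          (∀ e, e ∈ X ↔ ∃ i, e ∈ y.1.2.1 i) ∧
            Ψ y = Quotient.mk (markedSetoid n γ δ α) ⟨(M, X), hM⟩ := by
  classical
  choose M hM hMy using fun y : separatedFactorizationsWith n γ δ α =>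
    exists_isBernardiMap hn hγ hδ (forgetSets y).2
  let X : separatedFactorizationsWith n γ δ α → Finset (Fin n) := fun y =>
    Finset.univ.filter fun e => ∃ i, e ∈ y.1.2.1 i
  have hX : ∀ y e, e ∈ X y ↔ ∃ i, e ∈ y.1.2.1 i := fun y e => by simp [X]
  have hMX : ∀ y, (M y).HasDegrees γ δ ∧ (M y).IsMarking α (X y) := fun y =>
    ⟨hM y, (hMy y).isMarking y (hX y)⟩
  have hset : ∀ (y : separatedFactorizationsWith n γ δ α) i e,
      e ∈ y.1.2.1 i ↔ e ∈ X y ∧ y.1.2.2.2 e = Fin.castAdd r i := by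
    intro y i e
    rw [hX]
    refine ⟨fun he => ⟨⟨i, he⟩, y.2.1.2.2.2.2 i e he⟩, ?_⟩
    rintro ⟨⟨j, hj⟩, he⟩
    rw [y.2.1.2.2.2.2 j e hj, Fin.castAdd_inj] at he
    rwa [← he]
  refine ⟨Equiv.ofBijective
    (fun y => Quotient.mk (markedSetoid n γ δ α) ⟨(M y, X y), hMX y⟩) ⟨fun y y' h => ?_,
      fun z => ?_⟩, fun y => ⟨M y, X y, hMX y, hMy y, hX y, rfl⟩⟩
  · obtain ⟨φ, hφ, hφX⟩ := Quotient.exact h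
    obtain ⟨rfl, hxx⟩ := (hMy y).eq_of_isIso hγ hδ (forgetSets y).2 (forgetSets y').2 (hMy y') hφ
    have hπ : (forgetSets y).1.1 = (forgetSets y').1.1 := congrArg Prod.fst hxx
    have hc : (forgetSets y).1.2 = (forgetSets y').1.2 := congrArg Prod.snd hxx
    change y.1.2.2 = y'.1.2.2 at hc
    refine Subtype.ext (Prod.ext hπ (Prod.ext (funext fun i => Finset.ext fun e => ?_) hc))
    rw [hset, hset, hc]
    exact and_congr_left fun _ => (hφX e).symm
  · induction z using Quotient.inductionOn with
    | _ P =>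
      obtain ⟨⟨N₀, X₀⟩, hdeg, hmark⟩ := P
      obtain ⟨x, hx, N, φ, hN, hφ⟩ := exists_isIso_isBernardiMap hγ hδ N₀ hdeg
      let A : Fin k → Finset (Fin n) := fun i =>
        (X₀.filter fun e => N₀.whiteEnd e = Fin.castAdd r i).map φ.toEmbedding
      have hA : ∀ i e, φ e ∈ A i ↔ e ∈ X₀ ∧ N₀.whiteEnd e = Fin.castAdd r i := by
        intro i e
        simp [A]
      have hcol : ∀ e, x.2.2 (φ e) = N₀.whiteEnd e := fun e => by
        rw [← hN.whiteEnd, hφ.whiteEnd]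
      have hAcol : ∀ i, ∀ e ∈ A i, x.2.2 e = Fin.castAdd r i := by
        intro i e he
        obtain ⟨e, rfl⟩ := φ.surjective e
        rw [hcol]
        exact ((hA i e).1 he).2
      have hy : (x.1, A, x.2) ∈ separatedFactorizationsWith n γ δ α := by
        refine ⟨⟨⟨fun i j hij => ?_, fun i => ?_⟩, hx.1, hx.2.1,
          surjective_of_colorCount hx.2.2 hδ, hAcol⟩, hx.2.2⟩
        · rw [Finset.disjoint_left]
          intro e hi hj
          refine hij (Fin.castAdd_injective k r ?_)
          rw [← hAcol i e hi, ← hAcol j e hj]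
        · rw [Finset.card_map]
          exact hmark.1 i
      refine ⟨⟨_, hy⟩, Quotient.sound ?_⟩
      have hNM : N = M ⟨_, hy⟩ := hN.unique (hMy ⟨_, hy⟩)
      refine (markedSetoid n γ δ α).symm' ⟨φ, hNM ▸ hφ, fun e => ?_⟩
      rw [hX]
      simp only [hA]
      constructor
      · exact fun ⟨_, he, _⟩ => he
      · intro he
        obtain ⟨i, hi⟩ := hmark.2 e he
        exact ⟨i, he, hi⟩

theorem forgetMarks_bernardi {k r : ℕ} {δ : Fin (k + r) → ℕ} {α : Fin k → ℕ}
    {Φ : coloredFactorizations n γ δ → TreeRootedMaps n γ δ}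
    (hΦ : ∀ x, ∃ (M : TreeRootedMap n l (k + r)) (hM : M.HasDegrees γ δ),
      IsBernardiMap x.1 M ∧ Φ x = Quotient.mk (treeRootedSetoid n γ δ) ⟨M, hM⟩)
    {Ψ : separatedFactorizationsWith n γ δ α → MarkedTreeRootedMaps n γ δ α}
    (hΨ : ∀ y, ∃ (M : TreeRootedMap n l (k + r)) (X : Finset (Fin n))
      (hM : M.HasDegrees γ δ ∧ M.IsMarking α X), IsBernardiMap (forgetSets y).1 M ∧
        (∀ e, e ∈ X ↔ ∃ i, e ∈ y.1.2.1 i) ∧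
          Ψ y = Quotient.mk (markedSetoid n γ δ α) ⟨(M, X), hM⟩)
    (y : separatedFactorizationsWith n γ δ α) : forgetMarks (Ψ y) = Φ (forgetSets y) := by
  obtain ⟨M, X, hM, hMy, -, hy⟩ := hΨ y
  obtain ⟨M', hM', hMy', hx⟩ := hΦ (forgetSets y)
  obtain rfl := hMy.unique hMy'
  rw [hy, hx]
  rfl

end SepMaps

/-! ### Tree-rooted maps as matchings of half-edges -/

namespace SepMaps

theorem Rooted.congr {V : Type*} {r : V} {p p' : V → V} (h : Rooted r p)
    (hp : ∀ a, a ≠ r → p' a = p a) : Rooted r p' := fun v =>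
  Relation.ReflTransGen.mono (fun a _ hac => ⟨hac.1, (hp a hac.1).trans hac.2⟩) _ _ (h v)

/-- Suppose that `p` leads to `r`, but no longer does so when the value `u` at `i` is replaced by
`v`. Then the opposite holds after the values at `u` and `v` are exchanged. -/
theorem Rooted.exchange {V : Type*} {r i u v : V} {p p' q q' : V → V} (hi : i ≠ r) (hu : u ≠ r)
    (hv : v ≠ r) (hiu : i ≠ u) (hiv : i ≠ v) (huv : u ≠ v) (hpi : p i = u)
    (hp'i : p' i = v) (hp' : ∀ a, a ≠ r → a ≠ i → p' a = p a)
    (hqi : q i = u) (hqu : q u = p v)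
    (hq : ∀ a, a ≠ r → a ≠ i → a ≠ u → a ≠ v → q a = p a)
    (hq'i : q' i = v) (hq'u : q' u = p v) (hq'v : q' v = p u)
    (hq' : ∀ a, a ≠ r → a ≠ i → a ≠ u → a ≠ v → q' a = p a)
    (h : Rooted r p) (h' : ¬ Rooted r p') : Rooted r q' ∧ ¬ Rooted r q := by
  set R : V → V → Prop := fun a c => a ≠ r ∧ p a = c
  -- Redirecting `i` to `v` can destroy rootedness only by closing a cycle, so the `p`-path of `v`
  -- passes through `i`, and then through `u`.
  have hvi : Relation.ReflTransGen R v i := by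
    by_contra hcon
    have h1 : ∀ a, ¬ Relation.ReflTransGen R a i →
        Relation.ReflTransGen (fun a c => a ≠ r ∧ p' a = c) a r := by
      intro a
      induction h a using Relation.ReflTransGen.head_induction_on with
      | refl => exact fun _ => .refl
      | @head a c hac _ ih =>
        intro ha
        refine .head ⟨hac.1, (hp' a hac.1 ?_).trans hac.2⟩ (ih fun hc => ha (.head hac hc))
        rintro rfl
        exact ha .refl
    refine h' fun a => ?_
    induction h a using Relation.ReflTransGen.head_induction_on with
    | refl => exact .refl
    | @head a c hac _ ih =>
      by_cases hai : a = i
      · rw [hai]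
        exact .head ⟨hi, hp'i⟩ (h1 v hcon)
      · exact .head ⟨hac.1, (hp' a hac.1 hai).trans hac.2⟩ ih
  have hui : ¬ Relation.ReflTransGen R u i := by
    rw [← hpi]
    exact h.not_reflTransGen hi
  have hroot : ∀ c, Relation.ReflTransGen R r c → r = c := by
    intro c hc
    rcases hc.cases_head with h | ⟨d, hd, _⟩
    · exact h
    · exact absurd rfl hd.1
  have hpvi : Relation.ReflTransGen R (p v) i := by
    rcases hvi.cases_head with h | ⟨d, hd, hdi⟩
    · exact absurd h.symm hiv
    · rwa [hd.2]
  have hpvv : ¬ Relation.ReflTransGen R (p v) v := h.not_reflTransGen hv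
  constructor
  · have h1 : ∀ a, ¬ Relation.ReflTransGen R a i → ¬ Relation.ReflTransGen R a u →
        Relation.ReflTransGen (fun a c => a ≠ r ∧ q' a = c) a r := by
      intro a
      induction h a using Relation.ReflTransGen.head_induction_on with
      | refl => exact fun _ _ => .refl
      | @head a c hac _ ih =>
        intro hai hau
        refine .head ⟨hac.1, (hq' a hac.1 ?_ ?_ ?_).trans hac.2⟩
          (ih (fun hc => hai (.head hac hc)) fun hc => hau (.head hac hc))
        · rintro rfl
          exact hai .refl
        · rintro rfl
          exact hau .refl
        · rintro rfl
          exact hai hvi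
    -- Under `p` the path of `v` is `v → p v → ⋯ → i → u → p u → ⋯ → r`. Under `q'` it becomes `u →
    -- p v → ⋯ → i → v → p u → ⋯ → r`, with `u` and `v` interchanged.
    have h2 : Relation.ReflTransGen (fun a c => a ≠ r ∧ q' a = c) v r :=
      .head ⟨hv, hq'v⟩ (h1 _ (fun hc => hui (.head ⟨hu, rfl⟩ hc)) (h.not_reflTransGen hu))
    have h3 : Relation.ReflTransGen (fun a c => a ≠ r ∧ q' a = c) i r := .head ⟨hi, hq'i⟩ h2
    have h4 : ∀ a, Relation.ReflTransGen R a i → ¬ Relation.ReflTransGen R a v →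
        Relation.ReflTransGen (fun a c => a ≠ r ∧ q' a = c) a r := by
      intro a ha
      induction ha using Relation.ReflTransGen.head_induction_on with
      | refl => exact fun _ => h3
      | @head a c hac hci ih =>
        intro hav
        by_cases hai : a = i
        · rwa [hai]
        refine .head ⟨hac.1, (hq' a hac.1 hai ?_ ?_).trans hac.2⟩ (ih fun hc => hav (.head hac hc))
        · rintro rfl
          exact hui (.head hac hci)
        · rintro rfl
          exact hav .refl
    have h5 : Relation.ReflTransGen (fun a c => a ≠ r ∧ q' a = c) u r :=
      .head ⟨hu, hq'u⟩ (h4 _ hpvi hpvv)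
    intro a
    induction h a using Relation.ReflTransGen.head_induction_on with
    | refl => exact .refl
    | @head a c hac _ ih =>
      by_cases hai : a = i
      · rwa [hai]
      by_cases hau : a = u
      · rwa [hau]
      by_cases hav : a = v
      · rwa [hav]
      exact .head ⟨hac.1, (hq' a hac.1 hai hau hav).trans hac.2⟩ ih
  · intro hcon
    have hiv' : ¬ Relation.ReflTransGen R i v := by
      intro hc
      exact hpvv (hpvi.trans hc)
    -- Under `q` there is a cycle `i → u → p v → ⋯ → i`, so the path of `i` never reaches `r`.
    have h1 : ∀ c, Relation.ReflTransGen (fun a c => a ≠ r ∧ q a = c) i c →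
        (c ≠ r ∧ Relation.ReflTransGen R c i ∧ ¬ Relation.ReflTransGen R c v) ∨ c = u := by
      intro c hc
      induction hc with
      | refl => exact Or.inl ⟨hi, .refl, hiv'⟩
      | @tail a c _ hac ih =>
        rw [← hac.2]
        rcases ih with ⟨ha, hai, hav⟩ | rfl
        · by_cases hai' : a = i
          · rw [hai', hqi]
            exact Or.inr rfl
          rw [hq a ha hai' (by rintro rfl; exact hui hai) (by rintro rfl; exact hav .refl)]
          rcases hai.cases_head with h | ⟨d, hd, hdi⟩
          · exact absurd h hai'
          · rw [hd.2]
            refine Or.inl ⟨?_, hdi, fun hc => hav (.head hd hc)⟩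
            rintro rfl
            exact hi (hroot _ hdi).symm
        · rw [hqu]
          refine Or.inl ⟨?_, hpvi, hpvv⟩
          intro hr
          rw [hr] at hpvi
          exact hi (hroot _ hpvi).symm
    rcases h1 r (hcon i) with h2 | h2
    · exact h2.1 rfl
    · exact hu h2.symm

variable {n l l' : ℕ}

/-- The exits of the vertices, when the edges are named by their black half-edges, the matching
`m` gives the white half-edges of the edges, and the last half-edges around the black (resp.
white) vertices are given by `sB` (resp. `sW`). -/
def matchingExits (sB : Fin l → Fin n) (sW : Fin l' → Fin n) (m : Equiv.Perm (Fin n)) :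
    Fin l ⊕ Fin l' → Fin n :=
  Sum.elim sB fun j => m.symm (sW j)

/-- The pairs of a black vertex and a matching such that the last half-edges lead to the
vertex. -/
def rootedMatchings (b : Fin n → Fin l) (w : Fin n → Fin l') (sB : Fin l → Fin n)
    (sW : Fin l' → Fin n) : Set (Fin l × Equiv.Perm (Fin n)) :=
  {g | Rooted (Sum.inl g.1) (parent b (w ∘ g.2) (matchingExits sB sW g.2))}

section Matchings

variable {b : Fin n → Fin l} {w w' : Fin n → Fin l'} {sB : Fin l → Fin n} {sW : Fin l' → Fin n}

/-- Multiplying by the transposition exchanges the exits of the white vertices `w x` and `w' x`;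
this is the situation of `Rooted.exchange`, with `i` the black vertex whose last half-edge is
matched to `x`. -/
theorem swap_mem_rootedMatchings (hB : ∀ i, b (sB i) = i) (hW : ∀ j, w (sW j) = j)
    (hW' : ∀ j, w' (sW j) = j) {x : Fin n} (hx : ∀ y, y ≠ x → w' y = w y) (hne : w x ≠ w' x)
    {g : Fin l × Equiv.Perm (Fin n)} (hg : g ∈ rootedMatchings b w sB sW)
    (hg' : g ∉ rootedMatchings b w' sB sW) :
    (g.1, Equiv.swap (sW (w x)) (sW (w' x)) * g.2) ∈ rootedMatchings b w' sB sW ∧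
      (g.1, Equiv.swap (sW (w x)) (sW (w' x)) * g.2) ∉ rootedMatchings b w sB sW := by
  obtain ⟨β, m⟩ := g
  have hxW : ∀ j, x ≠ sW j := by
    rintro j rfl
    exact hne (by rw [hW, hW'])
  -- If `x` were not matched to the last half-edge of a black vertex other than `β`, moving it would
  -- change no relevant exit.
  obtain ⟨i, hiβ, hi⟩ : ∃ i, i ≠ β ∧ m (sB i) = x := by
    by_contra! hcon
    refine hg' (Rooted.congr hg ?_)
    rintro (i | j) ha
    · exact congrArg Sum.inr (hx _ (hcon i fun h => ha (congrArg _ h)))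
    · rfl
  -- Two matched last half-edges would make their vertices point to each other. Hence the
  -- transposition leaves the exits of the black vertices other than `β` alone.
  have hsBW : ∀ i', i' ≠ β → ∀ j, m (sB i') ≠ sW j := by
    intro i' hi' j hj
    refine Rooted.not_reflTransGen hg (fun h => hi' (Sum.inl_injective h))
      (.single ⟨Sum.inr_ne_inl, ?_⟩)
    simp only [parent, matchingExits, Sum.elim_inl, Sum.elim_inr, Function.comp_apply, hj, hW]
    rw [← hj, Equiv.symm_apply_apply, hB]
  have hswap : ∀ i', i' ≠ β →
      (Equiv.swap (sW (w x)) (sW (w' x)) * m) (sB i') = m (sB i') := fun i' hi' =>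
    Equiv.swap_apply_of_ne_of_ne (hsBW i' hi' _) (hsBW i' hi' _)
  have hsymm : ∀ y, (Equiv.swap (sW (w x)) (sW (w' x)) * m).symm y =
      m.symm (Equiv.swap (sW (w x)) (sW (w' x)) y) := fun y => rfl
  have hother : ∀ j, j ≠ w x → j ≠ w' x →
      Equiv.swap (sW (w x)) (sW (w' x)) (sW j) = sW j := fun j h1 h2 =>
    Equiv.swap_apply_of_ne_of_ne (fun h => h1 (by rw [← hW j, h, hW]))
      fun h => h2 (by rw [← hW j, h, hW])
  have hmne : ∀ i', i' ≠ i → m (sB i') ≠ x := fun i' hi' h =>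
    hi' (by rw [← hB i', m.injective (h.trans hi.symm), hB])
  refine Rooted.exchange (i := Sum.inl i) (u := Sum.inr (w x)) (v := Sum.inr (w' x))
    (p := parent b (w ∘ m) (matchingExits sB sW m))
    (p' := parent b (w' ∘ m) (matchingExits sB sW m)) (fun h => hiβ (Sum.inl_injective h))
    Sum.inr_ne_inl Sum.inr_ne_inl Sum.inl_ne_inr Sum.inl_ne_inr
    (fun h => hne (Sum.inr_injective h)) (congrArg (fun y => Sum.inr (w y)) hi)
    (congrArg (fun y => Sum.inr (w' y)) hi) ?_ ?_ ?_ ?_ ?_ ?_ ?_ ?_ hg hg'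
  · rintro (i' | j) h1 h2
    · exact congrArg Sum.inr (hx _ (hmne i' fun h => h2 (congrArg _ h)))
    · rfl
  · simp only [parent, matchingExits, Sum.elim_inl, Function.comp_apply, hswap i hiβ, hi]
  · simp only [parent, matchingExits, Sum.elim_inr, hsymm, Equiv.swap_apply_left]
  · rintro (i' | j) h1 h2 h3 h4
    · simp only [parent, matchingExits, Sum.elim_inl, Function.comp_apply,
        hswap i' fun h => h1 (congrArg _ h)]
    · simp only [parent, matchingExits, Sum.elim_inr, hsymm,
        hother j (fun h => h3 (congrArg _ h)) fun h => h4 (congrArg _ h)]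
  · simp only [parent, matchingExits, Sum.elim_inl, Function.comp_apply, hswap i hiβ, hi]
  · simp only [parent, matchingExits, Sum.elim_inr, hsymm, Equiv.swap_apply_left]
  · simp only [parent, matchingExits, Sum.elim_inr, hsymm, Equiv.swap_apply_right]
  · rintro (i' | j) h1 h2 h3 h4
    · simp only [parent, matchingExits, Sum.elim_inl, Function.comp_apply,
        hswap i' fun h => h1 (congrArg _ h)]
      rw [hx _ (hmne i' fun h => h2 (congrArg _ h))]
    · simp only [parent, matchingExits, Sum.elim_inr, hsymm,
        hother j (fun h => h3 (congrArg _ h)) fun h => h4 (congrArg _ h)]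

/-- Moving one half-edge to another white vertex does not change the number of matchings. -/
theorem ncard_rootedMatchings_of_eq_off (hB : ∀ i, b (sB i) = i) (hW : ∀ j, w (sW j) = j)
    (hW' : ∀ j, w' (sW j) = j) {x : Fin n} (hx : ∀ y, y ≠ x → w' y = w y) :
    (rootedMatchings b w sB sW).ncard = (rootedMatchings b w' sB sW).ncard := by
  by_cases hne : w x = w' x
  · have : w' = w := by
      funext y
      by_cases hy : y = x
      · rw [hy, hne]
      · exact hx y hy
    rw [this]
  have hinj : ∀ (u v : Fin n), Function.Injective fun g : Fin l × Equiv.Perm (Fin n) =>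
      (g.1, Equiv.swap u v * g.2) := by
    intro u v g g' h
    rw [Prod.mk.injEq] at h
    exact Prod.ext h.1 (mul_left_cancel h.2)
  have h1 : (rootedMatchings b w sB sW \ rootedMatchings b w' sB sW).ncard ≤
      (rootedMatchings b w' sB sW \ rootedMatchings b w sB sW).ncard :=
    Set.ncard_le_ncard_of_injOn _
      (fun g hg => swap_mem_rootedMatchings hB hW hW' hx hne hg.1 hg.2) (hinj _ _).injOn
  have h2 : (rootedMatchings b w' sB sW \ rootedMatchings b w sB sW).ncard ≤
      (rootedMatchings b w sB sW \ rootedMatchings b w' sB sW).ncard :=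
    Set.ncard_le_ncard_of_injOn _
      (fun g hg => swap_mem_rootedMatchings hB hW' hW (fun y hy => (hx y hy).symm)
        (Ne.symm hne) hg.1 hg.2) (hinj _ _).injOn
  rw [← Set.ncard_inter_add_ncard_sdiff_eq_ncard (rootedMatchings b w sB sW)
      (rootedMatchings b w' sB sW),
    ← Set.ncard_inter_add_ncard_sdiff_eq_ncard (rootedMatchings b w' sB sW)
      (rootedMatchings b w sB sW), le_antisymm h1 h2, Set.inter_comm]

theorem ncard_rootedMatchings_eq (hB : ∀ i, b (sB i) = i) (hW : ∀ j, w (sW j) = j)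
    (hW' : ∀ j, w' (sW j) = j) :
    (rootedMatchings b w sB sW).ncard = (rootedMatchings b w' sB sW).ncard := by
  -- The half-edges are moved one at a time; the designated last ones have the same vertex in `w`
  -- and `w'`, so they stay put.
  have main : ∀ S : Finset (Fin n), (rootedMatchings b w sB sW).ncard =
      (rootedMatchings b (fun y => if y ∈ S then w' y else w y) sB sW).ncard := by
    intro S
    induction S using Finset.induction_on with
    | empty => simp
    | insert x S _ ih =>
      rw [ih]
      refine ncard_rootedMatchings_of_eq_off (x := x) hB (fun j => ?_) (fun j => ?_)
        fun y hy => ?_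
      · simp only [hW, hW', ite_self]
      · simp only [hW, hW', ite_self]
      · simp only [Finset.mem_insert, hy, false_or]
  simpa using main Finset.univ

end Matchings

end SepMaps

/-! ### The number of colored factorizations -/

namespace SepMaps

variable {n l l' : ℕ}

theorem exists_perm_comp_eq {q : ℕ} {b c : Fin n → Fin q}
    (h : ∀ i, colorCount b i = colorCount c i) : ∃ z : Equiv.Perm (Fin n), ∀ t, b (z t) = c t := by
  have hfib : ∀ i, Nonempty ({t // c t = i} ≃ {t // b t = i}) := fun i => by
    refine ⟨Fintype.equivOfCardEq ?_⟩
    rw [Fintype.card_subtype, Fintype.card_subtype]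
    exact (h i).symm
  exact ⟨(Equiv.sigmaFiberEquiv c).symm.trans
    ((Equiv.sigmaCongrRight fun i => (hfib i).some).trans (Equiv.sigmaFiberEquiv b)),
    fun t => ((hfib (c t)).some ⟨t, rfl⟩).2⟩

/-- The elements of `Fin n` can be listed so that their colors are given by `c` and so that the
elements of each color are in increasing order. -/
theorem exists_perm_mono {q : ℕ} {b c : Fin n → Fin q} {o : Fin n → ℕ}
    (h : ∀ i, colorCount b i = colorCount c i)
    (ho : ∀ e f, b e = b f → o e = o f → e = f) :
    ∃ z : Equiv.Perm (Fin n), (∀ t, b (z t) = c t) ∧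
      ∀ s t, b (z s) = b (z t) → s < t → o (z s) < o (z t) := by
  obtain ⟨z₀, hz₀⟩ := exists_perm_comp_eq h
  let f : Fin n → Fin q ×ₗ ℕ := fun e => toLex (b e, o e)
  let g : Fin n → Fin q ×ₗ Fin n := fun t => toLex (c t, t)
  have hf : Monotone (f ∘ Tuple.sort f) := Tuple.monotone_sort f
  have hg : Monotone (g ∘ Tuple.sort g) := Tuple.monotone_sort g
  have hfst : ∀ {α : Type} [LinearOrder α], Monotone fun y : Fin q ×ₗ α => (ofLex y).1 :=
    fun {α} _ => Prod.Lex.monotone_fst_ofLex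
  have hbf : Monotone (b ∘ Tuple.sort f) := fun s t hst => hfst (hf hst)
  have hbg : Monotone (b ∘ (z₀ * Tuple.sort g : Equiv.Perm (Fin n))) := by
    intro s t hst
    have : c (Tuple.sort g s) ≤ c (Tuple.sort g t) := hfst (hg hst)
    simpa [hz₀] using this
  -- Sort the elements by color and `o`, and the positions by color and value. Equal color counts
  -- make the colors in corresponding places of the two sorted lists agree.
  have heq := Tuple.unique_monotone hbf hbg
  have hb : ∀ t, b (Tuple.sort f ((Tuple.sort g).symm t)) = c t := fun t => by
    have := congrFun heq ((Tuple.sort g).symm t)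
    simpa [hz₀] using this
  refine ⟨(Tuple.sort g).symm.trans (Tuple.sort f), hb, fun s t hst hlt => ?_⟩
  have hcst : c s = c t := by rw [← hb, ← hb]; exact hst
  have hle : (Tuple.sort g).symm s ≤ (Tuple.sort g).symm t := by
    by_contra! hcon
    have := hg hcon.le
    simp only [Function.comp_apply, Equiv.apply_symm_apply, g, Prod.Lex.toLex_le_toLex',
      hcst] at this
    exact absurd (this.2 trivial) (not_le_of_gt hlt)
  have hfle := (Prod.Lex.toLex_le_toLex'.1 (hf hle)).2 hst
  refine lt_of_le_of_ne hfle fun h => hlt.ne ?_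
  exact (Equiv.injective _) (ho _ _ hst h)

/-- The elements `s i` come last. -/
def lastOrder {q : ℕ} (v : Fin n → Fin q) (s : Fin q → Fin n) (e : Fin n) : ℕ :=
  if s (v e) = e then n else e

theorem lastOrder_inj {q : ℕ} {v : Fin n → Fin q} {s : Fin q → Fin n} (e f : Fin n)
    (hef : v e = v f) (h : lastOrder v s e = lastOrder v s f) : e = f := by
  rw [lastOrder, lastOrder, hef] at h
  split_ifs at h with h1 h2 h2
  · rw [← h1, h2]
  · exact absurd h f.2.ne'
  · exact absurd h e.2.ne
  · exact Fin.ext h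

theorem lastOrder_le {q : ℕ} {v : Fin n → Fin q} {s : Fin q → Fin n} (hs : ∀ i, v (s i) = i)
    (e : Fin n) : lastOrder v s e ≤ lastOrder v s (s (v e)) := by
  have h : lastOrder v s (s (v e)) = n := if_pos (by rw [hs])
  rw [h, lastOrder]
  split_ifs
  · exact le_rfl
  · exact e.2.le

section Count

variable {γ : Fin l → ℕ} {δ : Fin l' → ℕ} {b : Fin n → Fin l} {w : Fin n → Fin l'}
  {sB : Fin l → Fin n} {sW : Fin l' → Fin n}

theorem isLast_matchingExits (hB : ∀ i, b (sB i) = i) (hW : ∀ j, w (sW j) = j)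
    (m : Equiv.Perm (Fin n)) :
    IsLast b (w ∘ m) (lastOrder b sB) (lastOrder w sW ∘ m) (matchingExits sB sW m) where
  black := hB
  white j := by simp [matchingExits, hW]
  black_le := lastOrder_le hB
  white_le e := by
    simp only [Function.comp_apply, matchingExits, Sum.elim_inr, Equiv.apply_symm_apply]
    exact lastOrder_le hW _

/-- The tours of rooted matchings are in bijection with the colored factorizations. -/
theorem ncard_coloredFactorizations (hn : 0 < n) (hb : ∀ i, colorCount b i = γ i)
    (hw : ∀ j, colorCount w j = δ j) (hB : ∀ i, b (sB i) = i) (hW : ∀ j, w (sW j) = j) :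
    (coloredFactorizations n γ δ).ncard = (rootedMatchings b w sB sW).ncard := by
  have hex : ∀ g : Fin l × Equiv.Perm (Fin n), ∃ X Y : Equiv.Perm (Fin n),
      g ∈ rootedMatchings b w sB sW →
        IsTour b (w ∘ g.2) (lastOrder b sB) (lastOrder w sW ∘ g.2) X Y ∧
          ∀ t : Fin n, (t : ℕ) = 0 → b (X t) = g.1 := by
    intro g
    by_cases hg : g ∈ rootedMatchings b w sB sW
    · obtain ⟨X, Y, h⟩ := exists_isTour lastOrder_inj
        (fun e f hef h => g.2.injective (lastOrder_inj _ _ hef h))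
        (isLast_matchingExits hB hW g.2) hg
      exact ⟨X, Y, fun _ => h⟩
    · exact ⟨1, 1, fun h => absurd h hg⟩
  choose X Y hXY using hex
  symm
  -- Half-edge names are replaced by the times of the tour. They can be recovered, because the
  -- half-edges around each vertex are used in a prescribed order.
  refine Set.ncard_congr (fun g _ => (((X g)⁻¹ * Y g) * (finRotate n)⁻¹, b ∘ X g,
    w ∘ g.2 ∘ X g)) ?_ ?_ ?_
  · intro g hg
    obtain ⟨hT, h0⟩ := hXY g hg
    have hprod : prodCycle (((X g)⁻¹ * Y g) * (finRotate n)⁻¹) = (X g)⁻¹ * Y g :=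
      inv_mul_cancel_right _ _
    refine ⟨⟨isCycleColoring_of_apply_eq fun e => ?_, fun i => ?_⟩,
      isCycleColoring_of_apply_eq fun e => ?_, fun i => ?_⟩
    · obtain ⟨e, rfl⟩ := (finRotate n).surjective e
      change b (X g ((X g).symm (Y g ((finRotate n).symm (finRotate n e))))) =
        b (X g (finRotate n e))
      rw [Equiv.apply_symm_apply, Equiv.symm_apply_apply]
      exact hT.black_eq e
    · exact (colorCount_comp b _ i).trans (hb i)
    · rw [hprod]
      change w (g.2 (X g ((X g).symm (Y g e)))) = w (g.2 (X g e))
      rw [Equiv.apply_symm_apply]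
      exact hT.white_eq e
    · exact (colorCount_comp w (g.2 * X g) i).trans (hw i)
  · intro g g' hg hg' heq
    obtain ⟨hT, h0⟩ := hXY g hg
    obtain ⟨hT', h0'⟩ := hXY g' hg'
    rw [Prod.mk.injEq, Prod.mk.injEq] at heq
    obtain ⟨h1, h2, h3⟩ := heq
    have hX : X g = X g' := perm_eq_of_mono hT.black_mono hT'.black_mono (congrFun h2)
    have hY : Y g = Y g' := by
      have := mul_right_cancel h1
      rw [hX] at this
      exact mul_left_cancel this
    have hm : g.2 * Y g = g'.2 * Y g' := by
      refine perm_eq_of_mono (v := w) (o := lastOrder w sW) hT.white_mono hT'.white_mono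
        fun t => ?_
      exact (hT.white_eq t).trans ((congrFun h3 t).trans (hT'.white_eq t).symm)
    rw [hY] at hm
    refine Prod.ext ?_ (mul_right_cancel hm)
    rw [← h0 ⟨0, hn⟩ rfl, ← h0' ⟨0, hn⟩ rfl, hX]
  · rintro ⟨π, c₁, c₂⟩ hx
    have hT := isTour_of_mem hx
    obtain ⟨⟨hc₁, hγ⟩, hc₂, hδ⟩ := hx
    simp only at hc₁ hγ hc₂ hδ hT
    obtain ⟨Z, hZ, hZm⟩ := exists_perm_mono (b := b) (c := c₁) (o := lastOrder b sB)
      (fun i => (hb i).trans (hγ i).symm) lastOrder_inj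
    obtain ⟨U, hU, hUm⟩ := exists_perm_mono (b := w) (c := c₂) (o := lastOrder w sW)
      (fun i => (hw i).trans (hδ i).symm) lastOrder_inj
    set σ := prodCycle π with hσ
    -- `Z` and `U` list the black and white half-edges in the order in which the tour leaves through
    -- them. At time `t` the edge leaving its white end is `σ t`, whose black half-edge is `Z (σ
    -- t)`, so the matching must send this to `U t`.
    let m : Equiv.Perm (Fin n) := U * (Z * σ)⁻¹
    have hm : ∀ t, m (Z (σ t)) = U t := fun t => by
      change U (σ.symm (Z.symm (Z (σ t)))) = U t
      rw [Equiv.symm_apply_apply, Equiv.symm_apply_apply]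
    have hmZ : ∀ t, w (m (Z t)) = c₂ t := fun t => by
      obtain ⟨t, rfl⟩ := σ.surjective t
      rw [hm, hU, hc₂.apply_eq]
    have hTm : IsTour b (w ∘ m) (lastOrder b sB) (lastOrder w sW ∘ m) Z (Z * σ) := by
      refine ⟨fun t => ?_, fun t => ?_, hZm, fun s t hst hlt => ?_⟩
      · exact (hmZ _).trans ((hc₂.apply_eq t).trans (hmZ t).symm)
      · exact (hZ _).trans ((hT.black_eq t).trans (hZ _).symm)
      · have hst' : w (m (Z (σ s))) = w (m (Z (σ t))) := hst
        change lastOrder w sW (m (Z (σ s))) < lastOrder w sW (m (Z (σ t)))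
        rw [hm, hm] at hst' ⊢
        exact hUm s t hst' hlt
    let g : Fin l × Equiv.Perm (Fin n) := (b (Z ⟨0, hn⟩), m)
    have hg : g ∈ rootedMatchings b w sB sW :=
      hTm.rooted (isLast_matchingExits hB hW m) rfl
    refine ⟨g, hg, ?_⟩
    obtain ⟨hT', h0⟩ := hXY g hg
    obtain ⟨h1, h2⟩ := hT'.unique hTm fun t ht => by
      rw [h0 t ht]
      exact congrArg (fun t => b (Z t)) (Fin.ext ht.symm)
    rw [h1, h2, inv_mul_cancel_left, hσ]
    refine Prod.ext (mul_inv_cancel_right _ _) (Prod.ext (funext hZ) (funext hmZ))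

end Count

theorem exists_colorCount_eq {q : ℕ} {γ : Fin q → ℕ} (hγ : ∑ i, γ i = n) :
    ∃ b : Fin n → Fin q, ∀ i, colorCount b i = γ i := by
  subst hγ
  refine ⟨fun e => (finSigmaFinEquiv.symm e).1, fun i => ?_⟩
  rw [colorCount, ← Fintype.card_fin (γ i), ← Finset.card_univ]
  symm
  refine Finset.card_bij (fun a _ => finSigmaFinEquiv ⟨i, a⟩) ?_ ?_ ?_
  · intro a _
    simp
  · intro a _ a' _ h
    simpa using h
  · intro e he
    obtain ⟨⟨i', a⟩, rfl⟩ := finSigmaFinEquiv.surjective e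
    simp only [Finset.mem_filter, Finset.mem_univ, true_and, Equiv.symm_apply_apply] at he
    subst he
    exact ⟨a, Finset.mem_univ _, rfl⟩

/-- The number of colored factorizations only depends on the lengths of the compositions. -/
theorem ncard_coloredFactorizations_eq {γ : Fin l → ℕ} {δ δ' : Fin l' → ℕ} (hn : 0 < n)
    (hγ : IsComposition γ n) (hδ : IsComposition δ n) (hδ' : IsComposition δ' n) :
    (coloredFactorizations n γ δ).ncard = (coloredFactorizations n γ δ').ncard := by
  obtain ⟨b, hb⟩ := exists_colorCount_eq hγ.sum_eq
  obtain ⟨w, hw⟩ := exists_colorCount_eq hδ.sum_eq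
  obtain ⟨w', hw'⟩ := exists_colorCount_eq hδ'.sum_eq
  choose sB hB using surjective_of_colorCount hb hγ.pos
  choose sW hW using surjective_of_colorCount hw hδ.pos
  choose sW' hW' using surjective_of_colorCount hw' hδ'.pos
  -- The white half-edges of the second configuration are renamed so that both have the same
  -- designated last ones.
  obtain ⟨τ, hτ⟩ := Equiv.Perm.exists_extending_pair sW sW'
    (Function.LeftInverse.injective hW) (Function.LeftInverse.injective hW')
  have hτ' : ∀ j, (w' ∘ τ) (sW j) = j := fun j => by
    rw [Function.comp_apply, hτ, hW']
  rw [ncard_coloredFactorizations hn hb hw hB hW,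
    ncard_coloredFactorizations hn hb (fun i => (colorCount_comp w' τ i).trans (hw' i)) hB hτ']
  exact ncard_rootedMatchings_eq hB hW hτ'

end SepMaps

/-! ### The symmetry -/

namespace SepMaps

-- The generating function of `d.choose a` is `X ^ a / (1 - X) ^ (a + 1)`; multiplying by `1 - X`
-- takes differences, and Pascal's rule lowers `a`.
open PowerSeries in
theorem mk_choose_mul_one_sub_X_pow (a : ℕ) :
    (PowerSeries.mk fun d => (d.choose a : ℤ)) * (1 - X) ^ (a + 1) = X ^ a := by
  induction a with
  | zero =>
    simp only [Nat.choose_zero_right, Nat.cast_one, zero_add, pow_one, pow_zero]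
    exact PowerSeries.mk_one_mul_one_sub_eq_one ℤ
  | succ a ih =>
    have h : (PowerSeries.mk fun d => (d.choose (a + 1) : ℤ)) * (1 - X) =
        X * PowerSeries.mk fun d => (d.choose a : ℤ) := by
      ext d
      rw [mul_sub, mul_one, mul_comm _ X, map_sub]
      cases d with
      | zero => simp
      | succ d =>
        rw [coeff_succ_X_mul, coeff_succ_X_mul, coeff_mk, coeff_mk, coeff_mk,
          Nat.choose_succ_succ]
        push_cast
        ring
    rw [pow_succ' _ (a + 1), ← mul_assoc, h, mul_assoc, ih, ← pow_succ']

/-- The tuples of `q` positive integers summing to `n`. -/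
def compositions (n q : ℕ) : Finset (Fin q → ℕ) :=
  (Finset.univ.piAntidiag n).filter fun δ => ∀ i, 0 < δ i

theorem mem_compositions {n q : ℕ} {δ : Fin q → ℕ} :
    δ ∈ compositions n q ↔ IsComposition δ n := by
  rw [compositions, Finset.mem_filter, Finset.mem_piAntidiag]
  exact ⟨fun h => ⟨h.2, h.1.1⟩, fun h => ⟨⟨h.sum_eq, fun _ _ => Finset.mem_univ _⟩, h.pos⟩⟩

open PowerSeries in
theorem sum_compositions_prod {n q : ℕ} (f : Fin q → ℕ → ℤ) :
    ∑ δ ∈ compositions n q, ∏ i, f i (δ i) =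
      coeff n (∏ i, PowerSeries.mk fun d => if d = 0 then 0 else f i d) := by
  rw [coeff_prod, compositions, Finset.sum_filter]
  refine Finset.sum_equiv Finsupp.equivFunOnFinite.symm (fun δ => ?_) fun δ _ => ?_
  · simp [Finset.mem_piAntidiag, Finset.mem_finsuppAntidiag]
  · simp only [coeff_mk, Finsupp.equivFunOnFinite_symm_apply_apply]
    split_ifs with h
    · exact Finset.prod_congr rfl fun i _ => (if_neg (h i).ne').symm
    · push Not at h
      obtain ⟨i, hi⟩ := h
      refine (Finset.prod_eq_zero (Finset.mem_univ i) ?_).symm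
      exact if_pos (Nat.le_zero.1 hi)

open PowerSeries in
/-- The number of compositions of `n` of length `k + r` with `α i` chosen elements in the `i`-th
part only depends on the size and the length of `α`. -/
theorem sum_compositions_choose_eq {n m k r : ℕ} {α β : Fin k → ℕ} (hα : IsComposition α m)
    (hβ : IsComposition β m) :
    ∑ δ ∈ compositions n (k + r), ∏ i, (δ (Fin.castAdd r i)).choose (α i) =
      ∑ δ ∈ compositions n (k + r), ∏ i, (δ (Fin.castAdd r i)).choose (β i) := by
  have h1 : ∀ {α : Fin k → ℕ}, IsComposition α m →
      ((∑ δ ∈ compositions n (k + r), ∏ i, (δ (Fin.castAdd r i)).choose (α i) : ℕ) : ℤ) =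
        coeff n ((∏ i, PowerSeries.mk fun d => (d.choose (α i) : ℤ)) *
          ∏ _i : Fin r, PowerSeries.mk fun d => if d = 0 then 0 else 1) := by
    intro α hα
    have := sum_compositions_prod (n := n)
      fun (i : Fin (k + r)) d => (d.choose (Fin.append α 0 i) : ℤ)
    simp only [Fin.prod_univ_add, Fin.append_left, Fin.append_right, Pi.zero_apply,
      Nat.choose_zero_right, Nat.cast_one, Finset.prod_const_one, mul_one] at this
    push_cast
    rw [this]
    congr 2
    refine Finset.prod_congr rfl fun i _ => ?_
    congr 1
    funext d
    split_ifs with hd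
    -- As `α i` is positive, the coefficient at `d = 0` vanishes by itself, so the restriction to
    -- positive parts is invisible in the first `k` factors.
    · rw [hd, Nat.choose_eq_zero_of_lt (hα.pos i), Nat.cast_zero]
    · rfl
  have h2 : ∀ {α : Fin k → ℕ}, IsComposition α m →
      (∏ i, PowerSeries.mk fun d => (d.choose (α i) : ℤ)) * (1 - X) ^ (m + k) = X ^ m := by
    intro α hα
    have : m + k = ∑ i, (α i + 1) := by simp [Finset.sum_add_distrib, hα.sum_eq]
    rw [this, ← Finset.prod_pow_eq_pow_sum, ← Finset.prod_mul_distrib,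
      Finset.prod_congr rfl fun i _ => mk_choose_mul_one_sub_X_pow (α i),
      Finset.prod_pow_eq_pow_sum, hα.sum_eq]
  -- Both products become `X ^ m` after multiplication by the same power of `1 - X`, which can be
  -- cancelled.
  have hne : ((1 : ℤ⟦X⟧) - X) ^ (m + k) ≠ 0 := by
    refine pow_ne_zero _ fun h => ?_
    have := congrArg (constantCoeff (R := ℤ)) h
    simp at this
  have h3 := mul_right_cancel₀ hne ((h2 hα).trans (h2 hβ).symm)
  have : ((∑ δ ∈ compositions n (k + r), ∏ i, (δ (Fin.castAdd r i)).choose (α i) : ℕ) : ℤ) =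
      ((∑ δ ∈ compositions n (k + r), ∏ i, (δ (Fin.castAdd r i)).choose (β i) : ℕ) : ℤ) := by
    rw [h1 hα, h1 hβ, h3]
  exact_mod_cast this

/-! ### Counting separated factorizations by the color counts of `c₂`. -/

variable {n l k r : ℕ} {γ : Fin l → ℕ}

theorem isComposition_colorCount {q : ℕ} {c : Fin n → Fin q} (hc : Function.Surjective c) :
    IsComposition (colorCount c) n where
  pos i := by
    obtain ⟨e, he⟩ := hc i
    exact Finset.card_pos.2 ⟨e, by simpa using he⟩
  sum_eq := by
    have := Finset.card_eq_sum_card_fiberwise (f := c) (s := Finset.univ) (t := Finset.univ)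
      fun _ _ => Finset.mem_coe.2 (Finset.mem_univ _)
    rw [Finset.card_univ, Fintype.card_fin] at this
    exact this.symm

/-- Every colored factorization extends in `∏ i, (δ i).choose (α i)` ways. -/
theorem ncard_separatedFactorizationsWith {δ : Fin (k + r) → ℕ} (hδ : ∀ i, 0 < δ i)
    (α : Fin k → ℕ) :
    (separatedFactorizationsWith n γ δ α).ncard =
      (coloredFactorizations n γ δ).ncard * ∏ i, (δ (Fin.castAdd r i)).choose (α i) := by
  classical
  rw [Set.ncard_eq_toFinset_card', Set.ncard_eq_toFinset_card',
    Finset.card_eq_sum_card_fiberwise (f := fun y => (y.1, y.2.2))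
      (t := (coloredFactorizations n γ δ).toFinset), ← smul_eq_mul, ← Finset.sum_const]
  · refine Finset.sum_congr rfl fun x hx => ?_
    rw [Set.mem_toFinset] at hx
    -- Each `A i` is an arbitrary subset of size `α i` of the `i`-th color class; disjointness is
    -- automatic.
    have hcard : ∏ i, (δ (Fin.castAdd r i)).choose (α i) =
        (Fintype.piFinset fun i => Finset.powersetCard (α i)
          (Finset.univ.filter fun e => x.2.2 e = Fin.castAdd r i)).card := by
      rw [Fintype.card_piFinset]
      refine Finset.prod_congr rfl fun i _ => ?_
      rw [Finset.card_powersetCard, ← hx.2.2 (Fin.castAdd r i), colorCount]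
    rw [hcard]
    refine Finset.card_bij (fun y _ => y.2.1) ?_ ?_ ?_
    · rintro ⟨π, A, c⟩ hy
      rw [Finset.mem_filter, Set.mem_toFinset] at hy
      obtain ⟨hy, rfl⟩ := hy
      simp only [Fintype.mem_piFinset, Finset.mem_powersetCard]
      refine fun i => ⟨fun e he => ?_, hy.1.1.2 i⟩
      simpa using hy.1.2.2.2.2 i e he
    · rintro ⟨π, A, c⟩ hy ⟨π', A', c'⟩ hy' hA
      rw [Finset.mem_filter] at hy hy'
      have h := hy.2.trans hy'.2.symm
      rw [Prod.mk.injEq] at h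
      exact Prod.ext h.1 (Prod.ext hA h.2)
    · intro A hA
      simp only [Fintype.mem_piFinset, Finset.mem_powersetCard] at hA
      have hcol : ∀ i, ∀ e ∈ A i, x.2.2 e = Fin.castAdd r i := fun i e he => by
        simpa using (hA i).1 he
      refine ⟨(x.1, A, x.2), ?_, rfl⟩
      rw [Finset.mem_filter, Set.mem_toFinset]
      refine ⟨⟨⟨⟨fun i j hij => ?_, fun i => (hA i).2⟩, hx.1, hx.2.1,
        surjective_of_colorCount hx.2.2 hδ, hcol⟩, hx.2.2⟩, rfl⟩
      rw [Finset.disjoint_left]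
      intro e hi hj
      refine hij (Fin.castAdd_injective k r ?_)
      rw [← hcol i e hi, ← hcol j e hj]
  · intro y hy
    rw [Set.coe_toFinset] at hy ⊢
    exact (forgetSets ⟨y, hy⟩).2

theorem ncard_separatedFactorizations (α : Fin k → ℕ) :
    (separatedFactorizations n γ α r).ncard =
      ∑ δ ∈ compositions n (k + r),
        (coloredFactorizations n γ δ).ncard * ∏ i, (δ (Fin.castAdd r i)).choose (α i) := by
  classical
  rw [Set.ncard_eq_toFinset_card',
    Finset.card_eq_sum_card_fiberwise (f := fun y => colorCount y.2.2.2)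
      (t := compositions n (k + r))]
  · refine Finset.sum_congr rfl fun δ hδ => ?_
    rw [← ncard_separatedFactorizationsWith (mem_compositions.1 hδ).pos,
      Set.ncard_eq_toFinset_card']
    congr 1
    ext y
    rw [Finset.mem_filter, Set.mem_toFinset, Set.mem_toFinset, funext_iff]
    rfl
  · intro y hy
    rw [Set.coe_toFinset] at hy
    exact mem_compositions.2 (isComposition_colorCount hy.2.2.2.1)

theorem ncard_separatedFactorizations_eq (hn : 0 < n) (hγ : IsComposition γ n) {m : ℕ}
    {α β : Fin k → ℕ} (hα : IsComposition α m) (hβ : IsComposition β m) :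
    (separatedFactorizations n γ α r).ncard = (separatedFactorizations n γ β r).ncard := by
  rw [ncard_separatedFactorizations, ncard_separatedFactorizations]
  -- The common number of colored factorizations is read at some composition `δ₀`; if there is none,
  -- both sums are empty.
  rcases (compositions n (k + r)).eq_empty_or_nonempty with h | ⟨δ₀, hδ₀⟩
  · rw [h, Finset.sum_empty, Finset.sum_empty]
  have hconst : ∀ δ ∈ compositions n (k + r),
      (coloredFactorizations n γ δ).ncard = (coloredFactorizations n γ δ₀).ncard := fun δ hδ =>
    ncard_coloredFactorizations_eq hn hγ (mem_compositions.1 hδ) (mem_compositions.1 hδ₀)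
  have hsum : ∀ f : (Fin (k + r) → ℕ) → ℕ,
      ∑ δ ∈ compositions n (k + r), (coloredFactorizations n γ δ).ncard * f δ =
        (coloredFactorizations n γ δ₀).ncard * ∑ δ ∈ compositions n (k + r), f δ := fun f => by
    rw [Finset.mul_sum]
    exact Finset.sum_congr rfl fun δ hδ => by rw [hconst δ hδ]
  rw [hsum, hsum, sum_compositions_choose_eq hα hβ]

end SepMaps

theorem mainTheorem7 (n : ℕ) (hn : 0 < n) (l k r : ℕ) (γ : Fin l → ℕ)
    (hγ : SepMaps.IsComposition γ n) :
    (∀ δ : Fin (k + r) → ℕ, SepMaps.IsComposition δ n →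
      -- Bernardi's bijection
      ∃ Φ : SepMaps.coloredFactorizations n γ δ ≃ SepMaps.TreeRootedMaps n γ δ,
        (∀ x, ∃ (M : SepMaps.TreeRootedMap n l (k + r)) (hM : M.HasDegrees γ δ),
          SepMaps.IsBernardiMap x.1 M ∧
            Φ x = Quotient.mk (SepMaps.treeRootedSetoid n γ δ) ⟨M, hM⟩) ∧
        -- its extension
        ∀ (m : ℕ) (α : Fin k → ℕ), m ≤ n → SepMaps.IsComposition α m →
          ∃ Ψ : SepMaps.separatedFactorizationsWith n γ δ α ≃
              SepMaps.MarkedTreeRootedMaps n γ δ α,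
            (∀ y, SepMaps.forgetMarks (Ψ y) = Φ (SepMaps.forgetSets y)) ∧
            ∀ y, ∃ (M : SepMaps.TreeRootedMap n l (k + r)) (X : Finset (Fin n))
              (hM : M.HasDegrees γ δ ∧ M.IsMarking α X),
              SepMaps.IsBernardiMap (SepMaps.forgetSets y).1 M ∧
                (∀ e, e ∈ X ↔ ∃ i, e ∈ y.1.2.1 i) ∧
                Ψ y = Quotient.mk (SepMaps.markedSetoid n γ δ α) ⟨(M, X), hM⟩) ∧
    -- the symmetry
    ∀ (m : ℕ) (α β : Fin k → ℕ), m ≤ n → SepMaps.IsComposition α m →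
      SepMaps.IsComposition β m →
        (SepMaps.separatedFactorizations n γ α r).ncard =
          (SepMaps.separatedFactorizations n γ β r).ncard := by
  refine ⟨fun δ hδ => ?_, fun m α β _ hα hβ =>
    SepMaps.ncard_separatedFactorizations_eq hn hγ hα hβ⟩
  obtain ⟨Φ, hΦ⟩ := SepMaps.exists_bernardi_equiv hn hγ.pos hδ.pos
  refine ⟨Φ, hΦ, fun m α _ _ => ?_⟩
  obtain ⟨Ψ, hΨ⟩ := SepMaps.exists_marked_bernardi_equiv hn hγ.pos hδ.pos α
  exact ⟨Ψ, SepMaps.forgetMarks_bernardi hΦ hΨ, hΨ⟩
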